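/- Let $\mathbb S^2=\{x\in\mathbb R^3:|x|=1\}$, let $g_{\mathbb S^2}$ be the round metric on $\mathbb S^2$ induced from $\mathbb R^3$, let $f:\mathbb S^2\to\mathbb R$ be a smooth function, and let $g=e^{2f}g_{\mathbb S^2}$. Let $K_g$ be the Gauss curvature of $(\mathbb S^2,g)$ and $\mathrm{dvol}_g$ its Riemannian volume measure. Write $\tilde\nabla$ for the gradient with respect to $g$ and $\nabla$ for the gradient with respect to $g_{\mathbb S^2}$. A smooth vector field $X$ on $\mathbb S^2$ is called conformal Killing for $g$ if there is a function $\Omega$ on $\mathbb S^2$ with $\mathcal L_X g=\Omega\, g$. Then $K_g$ is smooth, and the following hold. 1. (Generalized Kazdan–Warner identity.) For every conformal Killing vector field $X$ of $(\mathbb S^2,g)$, the function $\langle\tilde\nabla K_g,X\rangle_g$ is integrable with respect to $\mathrm{dvol}_g$ and $$\int_{\mathbb S^2}\langle\tilde\nabla K_g,X\rangle_g\,\mathrm{dvol}_g=0 .$$ 2. (Kazdan–Warner identity.) Let $x_1,x_2,x_3$ be the restrictions to $\mathbb S^2$ of the coordinate functions of $\mathbb R^3$. For each $i=1,2,3$,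 the vector field $\nabla x_i$ is conformal Killing for $g$ (so that the identity in 1 holds for $X=\nabla x_i$), the function $\langle\nabla K_g,\nabla x_i\rangle_{g_{\mathbb S^2}}$ is integrable with respect to $\mathrm{dvol}_g$, and $$\int_{\mathbb S^2}\langle\nabla K_g,\nabla x_i\rangle_{g_{\mathbb S^2}}\,\mathrm{dvol}_g=0 .$$ -/

import Mathlib

open Set Metric MeasureTheory Bundle
open scoped Manifold ContDiff

noncomputable section

/-! ## Riemannian geometry in charts -/

section Riemannian

variable {n : ℕ} {M : Type*} [TopologicalSpace M] [ChartedSpace (EuclideanSpace ℝ (Fin n)) M]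
  [IsManifold (𝓡 n) ∞ M]

/-- Smooth Riemannian metrics on a smooth `n`-manifold `M`. -/
abbrev SmoothMetric (n : ℕ) (M : Type*) [TopologicalSpace M]
    [ChartedSpace (EuclideanSpace ℝ (Fin n)) M] [IsManifold (𝓡 n) ∞ M] : Type _ :=
  ContMDiffRiemannianMetric (𝓡 n) ∞ (EuclideanSpace ℝ (Fin n))
    (fun p : M ↦ TangentSpace (𝓡 n) p)

/-- A vector field on `M` is smooth if it is smooth as a map into the tangent bundle. -/
def IsSmoothVectorField (X : (p : M) → TangentSpace (𝓡 n) p) : Prop :=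
  ContMDiff (𝓡 n) (𝓡 n).tangent ∞ (fun p ↦ (⟨p, X p⟩ : TangentBundle (𝓡 n) M))

/-- The `i`-th coordinate vector field `∂_i` of the preferred chart at `p`, at the point with
coordinates `y`. -/
def coordVector (p : M) (i : Fin n) (y : EuclideanSpace ℝ (Fin n)) :
    TangentSpace (𝓡 n) ((chartAt (EuclideanSpace ℝ (Fin n)) p).symm y) :=
  mfderiv (𝓡 n) (𝓡 n) (chartAt (EuclideanSpace ℝ (Fin n)) p).symm y
    (EuclideanSpace.single i (1 : ℝ) : EuclideanSpace ℝ (Fin n))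

/-- The matrix `g_ij = g(∂_i, ∂_j)` of the metric in the preferred chart at `p`, as a function of
the coordinates. -/
def metricMatrix (g : SmoothMetric n M) (p : M) (y : EuclideanSpace ℝ (Fin n)) :
    Matrix (Fin n) (Fin n) ℝ :=
  Matrix.of fun i j ↦ g.inner ((chartAt (EuclideanSpace ℝ (Fin n)) p).symm y)
    (coordVector p i y) (coordVector p j y)

/-- The measure `√(det g_ij) dy` of the coordinate domain of the preferred chart at `p`, as a
measure on `M` (carried by the domain of the chart). -/
def chartVolume [MeasurableSpace M] (g : SmoothMetric n M) (p : M) : Measure M :=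
  Measure.map (chartAt (EuclideanSpace ℝ (Fin n)) p).symm
    ((volume.restrict (chartAt (EuclideanSpace ℝ (Fin n)) p).target).withDensity
      (fun y ↦ ENNReal.ofReal (Real.sqrt (metricMatrix g p y).det)))

/-- The Riemannian volume measure `dvol_g`: the smallest measure on `M` that dominates
`√(det g_ij) dy` in every preferred chart. Since these measures agree on overlaps of charts, this is
the measure which is given by `√(det g_ij) dy` in each chart. -/
def riemannianVolume [MeasurableSpace M] (g : SmoothMetric n M) : Measure M :=
  ⨆ p : M, chartVolume g p

/-- The gradient of `h` with respect to `g`: the image of `dh` under the inverse of the isomorphism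
`v ↦ g(v, ·)` from tangent vectors to covectors. -/
def metricGradient (g : SmoothMetric n M) (h : M → ℝ) (p : M) : TangentSpace (𝓡 n) p :=
  (g.inner p).inverse (mvfderiv (𝓡 n) h p)

theorem inner_isInvertible (g : SmoothMetric n M) (p : M) : (g.inner p).IsInvertible := by
  have : FiniteDimensional ℝ (TangentSpace (𝓡 n) p) :=
    inferInstanceAs (FiniteDimensional ℝ (EuclideanSpace ℝ (Fin n)))
  have : T2Space (TangentSpace (𝓡 n) p) :=
    inferInstanceAs (T2Space (EuclideanSpace ℝ (Fin n)))
  have : FiniteDimensional ℝ (TangentSpace (𝓡 n) p →L[ℝ] ℝ) :=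
    inferInstanceAs (FiniteDimensional ℝ (EuclideanSpace ℝ (Fin n) →L[ℝ] ℝ))
  have hinj : Function.Injective (g.inner p).toLinearMap := by
    rw [← LinearMap.ker_eq_bot, LinearMap.ker_eq_bot']
    intro v hv
    by_contra h
    have h0 : g.inner p v v = 0 := congrArg (fun φ : TangentSpace (𝓡 n) p →L[ℝ] ℝ ↦ φ v) hv
    exact (g.pos p v h).ne' h0
  have hdim : Module.finrank ℝ (TangentSpace (𝓡 n) p) =
      Module.finrank ℝ (TangentSpace (𝓡 n) p →L[ℝ] ℝ) := by
    rw [← LinearEquiv.finrank_eq (LinearMap.toContinuousLinearMap :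
      (TangentSpace (𝓡 n) p →ₗ[ℝ] ℝ) ≃ₗ[ℝ] _)]
    exact Subspace.dual_finrank_eq.symm
  exact ⟨(LinearEquiv.ofInjectiveOfFinrankEq _ hinj hdim).toContinuousLinearEquiv, by ext v; rfl⟩

/-- The characteristic property `g(grad h, v) = dh(v)` of the gradient. -/
theorem inner_metricGradient (g : SmoothMetric n M) (h : M → ℝ) (p : M)
    (v : TangentSpace (𝓡 n) p) :
    g.inner p (metricGradient g h p) v = mvfderiv (𝓡 n) h p v := by
  obtain ⟨e, he⟩ := inner_isInvertible g p
  rw [metricGradient, ← he, ContinuousLinearMap.inverse_equiv]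
  exact congrArg (fun φ : TangentSpace (𝓡 n) p →L[ℝ] ℝ ↦ φ v) (e.apply_symm_apply _)

/-- The Lie derivative `(L_X g)(Y, Z) = X(g(Y, Z)) - g([X, Y], Z) - g(Y, [X, Z])`. -/
def lieDerivMetric (g : SmoothMetric n M) (X Y Z : (p : M) → TangentSpace (𝓡 n) p) (p : M) : ℝ :=
  mvfderiv (𝓡 n) (fun q ↦ g.inner q (Y q) (Z q)) p (X p)
    - g.inner p (VectorField.mlieBracket (𝓡 n) X Y p) (Z p)
    - g.inner p (Y p) (VectorField.mlieBracket (𝓡 n) X Z p)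

/-- A conformal Killing vector field of `g` is a smooth vector field `X` for which `L_X g` is a
pointwise multiple of `g`. -/
def IsConformalKilling (g : SmoothMetric n M) (X : (p : M) → TangentSpace (𝓡 n) p) : Prop :=
  IsSmoothVectorField X ∧ ∃ Ω : M → ℝ, ∀ Y Z : (p : M) → TangentSpace (𝓡 n) p,
    IsSmoothVectorField Y → IsSmoothVectorField Z →
      ∀ p : M, lieDerivMetric g X Y Z p = Ω p * g.inner p (Y p) (Z p)

end Riemannian

/-! ## Curvature -/

section Curvature

variable {n : ℕ}

/-- The partial derivative `∂_k h` of a function of the coordinates. -/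
def partialDeriv (k : Fin n) (h : EuclideanSpace ℝ (Fin n) → ℝ) (y : EuclideanSpace ℝ (Fin n)) :
    ℝ :=
  fderiv ℝ h y (EuclideanSpace.single k 1)

/-- The Christoffel symbols
`Γ^k_ij = 1/2 ∑_l g^{kl} (∂_i g_jl + ∂_j g_il - ∂_l g_ij)` of a metric `G = (g_ij)` in coordinates.
-/
def christoffel (G : EuclideanSpace ℝ (Fin n) → Matrix (Fin n) (Fin n) ℝ) (k i j : Fin n)
    (y : EuclideanSpace ℝ (Fin n)) : ℝ :=
  (1 / 2 : ℝ) * ∑ l, (G y)⁻¹ k l *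
    (partialDeriv i (fun z ↦ G z j l) y + partialDeriv j (fun z ↦ G z i l) y
      - partialDeriv l (fun z ↦ G z i j) y)

/-- The components `R^l_kij` of the Riemann tensor, `R(∂_i, ∂_j) ∂_k = ∑_l R^l_kij ∂_l`, where
`R(X, Y) Z = ∇_X ∇_Y Z - ∇_Y ∇_X Z - ∇_[X, Y] Z`. -/
def riemannCoeff (G : EuclideanSpace ℝ (Fin n) → Matrix (Fin n) (Fin n) ℝ) (l k i j : Fin n)
    (y : EuclideanSpace ℝ (Fin n)) : ℝ :=
  partialDeriv i (christoffel G l j k) y - partialDeriv j (christoffel G l i k) y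
    + ∑ m, (christoffel G m j k y * christoffel G l i m y
      - christoffel G m i k y * christoffel G l j m y)

/-- The Gauss curvature `g(R(∂_0, ∂_1) ∂_1, ∂_0) / det(g_ij)` of a metric `G = (g_ij)` in two
coordinates. -/
def coordGaussCurvature (G : EuclideanSpace ℝ (Fin 2) → Matrix (Fin 2) (Fin 2) ℝ)
    (y : EuclideanSpace ℝ (Fin 2)) : ℝ :=
  (∑ l, riemannCoeff G l 1 0 1 y * G y l 0) / (G y).det

/-- The Gauss curvature `K_g` of a Riemannian surface, computed at each point `p` in the preferred
chart at `p`. -/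
def gaussCurvature {M : Type*} [TopologicalSpace M] [ChartedSpace (EuclideanSpace ℝ (Fin 2)) M]
    [IsManifold (𝓡 2) ∞ M] (g : SmoothMetric 2 M) (p : M) : ℝ :=
  coordGaussCurvature (metricMatrix g p) (chartAt (EuclideanSpace ℝ (Fin 2)) p p)

end Curvature

/-! ## The round sphere -/

/-- The unit sphere of `ℝ³`, with Mathlib's smooth structure (stereographic charts). -/
abbrev S2 : Type := sphere (0 : EuclideanSpace ℝ (Fin 3)) 1

/-- The differential at `p` of the inclusion of the sphere in `ℝ³`. -/
def inclDeriv (p : S2) : TangentSpace (𝓡 2) p →L[ℝ] EuclideanSpace ℝ (Fin 3) :=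
  mvfderiv (𝓡 2) (fun q : S2 ↦ (q : EuclideanSpace ℝ (Fin 3))) p

theorem inclDeriv_injective (p : S2) : Function.Injective (inclDeriv p) :=
  have : Fact (Module.finrank ℝ (EuclideanSpace ℝ (Fin 3)) = 2 + 1) := ⟨by simp⟩
  injective_mvfderiv_subtypeVal_sphere (n := 2) p

/-- The inner product induced on the tangent space at `p` by the inclusion. -/
def roundInner (p : S2) : TangentSpace (𝓡 2) p →L[ℝ] TangentSpace (𝓡 2) p →L[ℝ] ℝ :=
  (ContinuousLinearMap.precomp ℝ (inclDeriv p)).comp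
    ((innerSL ℝ (E := EuclideanSpace ℝ (Fin 3))).comp (inclDeriv p))

theorem roundInner_apply (p : S2) (v w : TangentSpace (𝓡 2) p) :
    roundInner p v w = inner ℝ (inclDeriv p v) (inclDeriv p w) := rfl

theorem roundInner_isVonNBounded (p : S2) :
    Bornology.IsVonNBounded ℝ {v : TangentSpace (𝓡 2) p | roundInner p v v < 1} := by
  obtain ⟨L, hL⟩ := (inclDeriv p).toLinearMap.exists_leftInverse_of_injective
    (LinearMap.ker_eq_bot.2 (inclDeriv_injective p))
  have hb := (NormedSpace.isVonNBounded_ball ℝ (EuclideanSpace ℝ (Fin 3)) 1).image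
    (LinearMap.toContinuousLinearMap L)
  refine Bornology.IsVonNBounded.subset (fun v hv ↦ ?_) hb
  refine ⟨inclDeriv p v, ?_, LinearMap.congr_fun hL v⟩
  have h1 : inner ℝ (inclDeriv p v) (inclDeriv p v) < (1 : ℝ) := hv
  rw [real_inner_self_eq_norm_sq] at h1
  rw [mem_ball_zero_iff]
  nlinarith [norm_nonneg (inclDeriv p v)]

theorem roundInner_inCoordinates (x p : S2)
    (hp : p ∈ (trivializationAt (EuclideanSpace ℝ (Fin 2)) (TangentSpace (𝓡 2)) x).baseSet)
    (v w : EuclideanSpace ℝ (Fin 2)) :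
    ((trivializationAt
      (EuclideanSpace ℝ (Fin 2) →L[ℝ] EuclideanSpace ℝ (Fin 2) →L[ℝ] ℝ)
      (fun p : S2 ↦ TangentSpace (𝓡 2) p →L[ℝ] TangentSpace (𝓡 2) p →L[ℝ] ℝ) x)
      ⟨p, roundInner p⟩).2 v w = roundInner p
        ((trivializationAt (EuclideanSpace ℝ (Fin 2)) (TangentSpace (𝓡 2)) x).symm p v)
        ((trivializationAt (EuclideanSpace ℝ (Fin 2)) (TangentSpace (𝓡 2)) x).symm p w) := by
  rw [hom_trivializationAt_apply]
  refine (inCoordinates_apply_eq₂ (F₃ := ℝ) (E₃ := Bundle.Trivial S2 ℝ) hp hp ?_).trans ?_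
  · exact mem_univ p
  · simp

theorem inclDeriv_inCoordinates (x p : S2)
    (hp : p ∈ (trivializationAt (EuclideanSpace ℝ (Fin 2)) (TangentSpace (𝓡 2)) x).baseSet)
    (u : EuclideanSpace ℝ (Fin 2)) :
    inTangentCoordinates (𝓡 2) 𝓘(ℝ, EuclideanSpace ℝ (Fin 3)) id
      (fun q : S2 ↦ (q : EuclideanSpace ℝ (Fin 3))) (mfderiv (𝓡 2) 𝓘(ℝ, EuclideanSpace ℝ (Fin 3))
      (fun q : S2 ↦ (q : EuclideanSpace ℝ (Fin 3)))) x p u = inclDeriv p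
        ((trivializationAt (EuclideanSpace ℝ (Fin 2)) (TangentSpace (𝓡 2)) x).symm p u) := by
  rw [← Bundle.Trivialization.symmL_apply (R := ℝ) _ hp]
  simp only [inTangentCoordinates, ContinuousLinearMap.inCoordinates]
  rw [TangentBundle.continuousLinearMapAt_model_space]
  rfl

theorem roundInner_contMDiff :
    ContMDiff (𝓡 2)
      ((𝓡 2).prod 𝓘(ℝ, EuclideanSpace ℝ (Fin 2) →L[ℝ] EuclideanSpace ℝ (Fin 2) →L[ℝ] ℝ)) ∞
      (fun p : S2 ↦ TotalSpace.mk'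
        (EuclideanSpace ℝ (Fin 2) →L[ℝ] EuclideanSpace ℝ (Fin 2) →L[ℝ] ℝ)
        (E := fun p : S2 ↦ TangentSpace (𝓡 2) p →L[ℝ] TangentSpace (𝓡 2) p →L[ℝ] ℝ)
        p (roundInner p)) := by
  have : Fact (Module.finrank ℝ (EuclideanSpace ℝ (Fin 3)) = 2 + 1) := ⟨by simp⟩
  intro x
  rw [contMDiffAt_section]
  have hB := (contMDiff_coe_sphere (m := ∞) (n := 2) (E := EuclideanSpace ℝ (Fin 3)) x).mfderiv_const
    (m := ∞) le_rfl
  let Φ : (EuclideanSpace ℝ (Fin 2) →L[ℝ] EuclideanSpace ℝ (Fin 3)) →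
      EuclideanSpace ℝ (Fin 2) →L[ℝ] EuclideanSpace ℝ (Fin 2) →L[ℝ] ℝ := fun b ↦
    ((ContinuousLinearMap.compL ℝ (EuclideanSpace ℝ (Fin 2)) (EuclideanSpace ℝ (Fin 3)) ℝ).flip
      b).comp ((innerSL ℝ).comp b)
  have hΦ : ContDiff ℝ ∞ Φ := by
    apply ContDiff.clm_comp
    · exact ContinuousLinearMap.contDiff _
    · exact contDiff_const.clm_comp contDiff_id
  have h := hΦ.contMDiff.contMDiffAt.comp x hB
  refine h.congr_of_eventuallyEq ?_
  have hx : (trivializationAt (EuclideanSpace ℝ (Fin 2)) (TangentSpace (𝓡 2)) x).baseSet ∈ nhds x :=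
    (trivializationAt _ _ x).open_baseSet.mem_nhds (FiberBundle.mem_baseSet_trivializationAt' x)
  filter_upwards [hx] with p hp
  ext v w
  refine (roundInner_inCoordinates x p hp v w).trans ?_
  rw [roundInner_apply, ← inclDeriv_inCoordinates x p hp v, ← inclDeriv_inCoordinates x p hp w]
  rfl

/-- The round metric `g_{S²}`, induced by the inclusion of the sphere in `ℝ³`. -/
def roundMetric : SmoothMetric 2 S2 where
  inner := roundInner
  symm p v w := real_inner_comm (inclDeriv p w) (inclDeriv p v)
  pos p v hv := real_inner_self_pos.2 fun h ↦ hv (inclDeriv_injective p (by simpa using h))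
  isVonNBounded := roundInner_isVonNBounded
  contMDiff := roundInner_contMDiff

/-- The coordinate function `x_i` of `ℝ³`, restricted to the sphere. -/
def coordFun (i : Fin 3) (p : S2) : ℝ := (p : EuclideanSpace ℝ (Fin 3)) i

end

noncomputable section

/-! ## Calculus in the plane -/

section PartialDeriv

variable {n : ℕ} {a b : EuclideanSpace ℝ (Fin n) → ℝ}

/-! Stereographic projection turns the sphere minus one point into the plane and `g` into
`e^{2u}|dy|²`, where `u = f + l` and `l = logConfFactor` is the round factor. There `K = -e^{-2u}
Δu`, and roundness is the Liouville equation `Δl = -e^{2l}`. The removed point is null for `dvol_g`,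
so everything reduces to the plane integral of `e^{2u} X(K)`.

A conformal Killing field `X = (a, b)` satisfies the Cauchy-Riemann equations in such a chart
(`IsConformalKilling.cauchyRiemann`), so its round divergence `Ω` solves `ΔΩ = -2 e^{2l} Ω`
(`planeLaplacian_conformalDiv`): it lies in the eigenspace of the first spherical harmonics. These
two facts make `e^{2u} X(K)` the flat divergence of the explicit field `kazdanWarnerFlux`
(`div_kazdanWarnerFlux`).

It remains to see that nothing is lost at infinity. Functions, gradients and fields that are smooth
on the compact sphere are bounded in the round metric; in the chart this makes the flux `O(e^l) =
O((1 + |y|)^{-2})` and its divergence `O(e^{2l})`, hence integrable. A cutoff argument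
(`integral_div_eq_zero`) then gives integral zero. The pairing of either gradient of `K` with `X` is
`dK(X)`, so both identities of the theorem are this one, the second with `X = ∇x_i`, whose chart
components are quadratic polynomials satisfying Cauchy-Riemann. -/

@[fun_prop]
theorem contDiff_partialDeriv (ha : ContDiff ℝ ∞ a) (k : Fin n) :
    ContDiff ℝ ∞ (partialDeriv k a) :=
  (ha.fderiv_right (m := ∞) le_rfl).clm_apply contDiff_const

theorem differentiable_of_smooth (ha : ContDiff ℝ ∞ a) : Differentiable ℝ a :=
  ha.differentiable (by simp)

theorem partialDeriv_const (k : Fin n) (c : ℝ) :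
    partialDeriv k (fun _ ↦ c) = fun _ ↦ 0 := by
  funext y; simp [partialDeriv]

theorem partialDeriv_add (k : Fin n) (ha : ContDiff ℝ ∞ a) (hb : ContDiff ℝ ∞ b) :
    partialDeriv k (fun y ↦ a y + b y) = fun y ↦ partialDeriv k a y + partialDeriv k b y := by
  funext y
  simp [partialDeriv, fderiv_fun_add (differentiable_of_smooth ha y) (differentiable_of_smooth hb y)]

theorem partialDeriv_sub (k : Fin n) (ha : ContDiff ℝ ∞ a) (hb : ContDiff ℝ ∞ b) :
    partialDeriv k (fun y ↦ a y - b y) = fun y ↦ partialDeriv k a y - partialDeriv k b y := by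
  funext y
  simp [partialDeriv, fderiv_fun_sub (differentiable_of_smooth ha y) (differentiable_of_smooth hb y)]

theorem partialDeriv_neg (k : Fin n) :
    partialDeriv k (fun y ↦ -a y) = fun y ↦ -partialDeriv k a y := by
  funext y
  simp [partialDeriv]

theorem partialDeriv_mul (k : Fin n) (ha : ContDiff ℝ ∞ a) (hb : ContDiff ℝ ∞ b) :
    partialDeriv k (fun y ↦ a y * b y) =
      fun y ↦ a y * partialDeriv k b y + partialDeriv k a y * b y := by
  funext y
  simp [partialDeriv, fderiv_fun_mul (differentiable_of_smooth ha y) (differentiable_of_smooth hb y),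
    mul_comm]

theorem partialDeriv_pow_two (k : Fin n) (ha : ContDiff ℝ ∞ a) :
    partialDeriv k (fun y ↦ a y ^ 2) = fun y ↦ 2 * a y * partialDeriv k a y := by
  simp only [pow_two, partialDeriv_mul k ha ha]
  funext y; ring

theorem partialDeriv_exp (k : Fin n) (ha : ContDiff ℝ ∞ a) :
    partialDeriv k (fun y ↦ Real.exp (a y)) = fun y ↦ Real.exp (a y) * partialDeriv k a y := by
  funext y
  simp [partialDeriv, fderiv_exp (differentiable_of_smooth ha y)]

theorem partialDeriv_comm (j k : Fin n) (ha : ContDiff ℝ ∞ a) :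
    partialDeriv j (partialDeriv k a) = partialDeriv k (partialDeriv j a) := by
  have key : ∀ (i l : Fin n) y, partialDeriv i (partialDeriv l a) y =
      fderiv ℝ (fderiv ℝ a) y (EuclideanSpace.single i 1) (EuclideanSpace.single l 1) := by
    intro i l y
    have hd : DifferentiableAt ℝ (fderiv ℝ a) y :=
      (ha.fderiv_right (m := ∞) le_rfl).differentiable (by simp) y
    unfold partialDeriv
    rw [fderiv_clm_apply hd (differentiableAt_const _)]
    simp
  funext y
  rw [key, key]
  exact (ha.contDiffAt.isSymmSndFDerivAt (by
    simpa using WithTop.coe_le_coe.2 (le_top (a := (2 : ℕ∞))))).eq _ _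

theorem fderiv_eq_sum_partialDeriv (y v : EuclideanSpace ℝ (Fin n)) :
    fderiv ℝ a y v = ∑ k, v k * partialDeriv k a y := by
  have hv : v = ∑ k, v k • (EuclideanSpace.single k (1 : ℝ)) := by
    conv_lhs => rw [← (EuclideanSpace.basisFun (Fin n) ℝ).sum_repr v]
    simp
  conv_lhs => rw [hv]
  simp [partialDeriv]

end PartialDeriv

/-- The flat Laplacian of the plane. -/
def planeLaplacian (h : EuclideanSpace ℝ (Fin 2) → ℝ) (y : EuclideanSpace ℝ (Fin 2)) : ℝ :=
  partialDeriv 0 (partialDeriv 0 h) y + partialDeriv 1 (partialDeriv 1 h) y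

@[fun_prop]
theorem contDiff_planeLaplacian {h : EuclideanSpace ℝ (Fin 2) → ℝ} (hh : ContDiff ℝ ∞ h) :
    ContDiff ℝ ∞ (planeLaplacian h) := by
  unfold planeLaplacian
  fun_prop

/-! ## Curvature of conformally flat metrics -/

section ConformalCurvature

variable {u : EuclideanSpace ℝ (Fin 2) → ℝ}

theorem christoffel_conformal (hu : ContDiff ℝ ∞ u) (k i j : Fin 2) :
    christoffel (fun y ↦ Real.exp (2 * u y) • (1 : Matrix (Fin 2) (Fin 2) ℝ)) k i j = fun y ↦
      (if j = k then 1 else 0) * partialDeriv i u y + (if i = k then 1 else 0) * partialDeriv j u y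
        - (if i = j then 1 else 0) * partialDeriv k u y := by
  funext y
  have hinv : (Real.exp (2 * u y) • (1 : Matrix (Fin 2) (Fin 2) ℝ))⁻¹ =
      Real.exp (-(2 * u y)) • (1 : Matrix (Fin 2) (Fin 2) ℝ) := by
    apply Matrix.inv_eq_right_inv
    rw [smul_mul_smul_comm, ← Real.exp_add]
    simp
  have hd : ∀ m p q : Fin 2,
      partialDeriv m (fun z ↦ (Real.exp (2 * u z) • (1 : Matrix (Fin 2) (Fin 2) ℝ)) p q) y =
        (if p = q then 1 else 0) * (Real.exp (2 * u y) * (2 * partialDeriv m u y)) := by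
    intro m p q
    by_cases h : p = q
    · subst h
      have h2 : ContDiff ℝ ∞ fun z ↦ 2 * u z := by fun_prop
      simp [partialDeriv_exp _ h2, partialDeriv_mul _ contDiff_const hu, partialDeriv_const]
    · simp [h, partialDeriv_const]
  have he : Real.exp (-(2 * u y)) * Real.exp (2 * u y) = 1 := by rw [← Real.exp_add]; simp
  simp only [christoffel, hinv, hd]
  fin_cases k <;> fin_cases i <;> fin_cases j <;>
    simp [Matrix.one_apply] <;> linear_combination (partialDeriv _ u y) * he

theorem coordGaussCurvature_conformal (hu : ContDiff ℝ ∞ u) (y : EuclideanSpace ℝ (Fin 2)) :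
    coordGaussCurvature (fun y ↦ Real.exp (2 * u y) • (1 : Matrix (Fin 2) (Fin 2) ℝ)) y =
      -Real.exp (-(2 * u y)) * planeLaplacian u y := by
  have he : Real.exp (-(2 * u y)) * Real.exp (2 * u y) = 1 := by rw [← Real.exp_add]; simp
  have hne := (Real.exp_pos (2 * u y)).ne'
  simp only [coordGaussCurvature, riemannCoeff, christoffel_conformal hu]
  simp [Matrix.one_apply, planeLaplacian, partialDeriv_neg]
  rw [Real.exp_neg]
  field_simp
  ring

end ConformalCurvature

/-! ## Conformal vector fields in the plane -/

section PlaneConformal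

variable {f l a b : EuclideanSpace ℝ (Fin 2) → ℝ}

/-- The divergence of the plane vector field `(a, b)` with respect to `e^{2l} |dy|²`. -/
def conformalDiv (l a b : EuclideanSpace ℝ (Fin 2) → ℝ) (y : EuclideanSpace ℝ (Fin 2)) : ℝ :=
  partialDeriv 0 a y + partialDeriv 1 b y + 2 * (a y * partialDeriv 0 l y + b y * partialDeriv 1 l y)

@[fun_prop]
theorem contDiff_conformalDiv (hl : ContDiff ℝ ∞ l) (ha : ContDiff ℝ ∞ a) (hb : ContDiff ℝ ∞ b) :
    ContDiff ℝ ∞ (conformalDiv l a b) := by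
  unfold conformalDiv
  fun_prop

/-- By Cauchy-Riemann, `a` and `b` are harmonic and the symmetric part of `DX` is `(div X / 2) I`.
Hence `Δ(X l) = X(Δl) + (div X) Δl`, while the flat `div X` is harmonic; inserting `Δl = -e^{2l}`
gives the claim. -/
theorem planeLaplacian_conformalDiv (hl : ContDiff ℝ ∞ l) (ha : ContDiff ℝ ∞ a)
    (hb : ContDiff ℝ ∞ b) (h0 : partialDeriv 0 b = fun y ↦ -partialDeriv 1 a y)
    (h1 : partialDeriv 1 b = partialDeriv 0 a)
    (hlap : ∀ y, planeLaplacian l y = -Real.exp (2 * l y)) (y : EuclideanSpace ℝ (Fin 2)) :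
    planeLaplacian (conformalDiv l a b) y = -2 * Real.exp (2 * l y) * conformalDiv l a b y := by
  -- Second derivatives `∂₁∂₁` are eliminated and mixed ones put in a fixed order, so that `ring`
  -- sees a normal form.
  have hl11 : partialDeriv 1 (partialDeriv 1 l) =
      fun y ↦ -Real.exp (2 * l y) - partialDeriv 0 (partialDeriv 0 l) y := by
    funext y; have := hlap y; unfold planeLaplacian at this; linarith
  have ha11 : partialDeriv 1 (partialDeriv 1 a) =
      fun y ↦ -partialDeriv 0 (partialDeriv 0 a) y := by
    have h := partialDeriv_comm 0 1 hb
    rw [h0, h1, partialDeriv_neg] at h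
    funext y; have := congrFun h y; linarith
  have cl := partialDeriv_comm 1 0 hl
  have ca := partialDeriv_comm 1 0 ha
  have cl0 := partialDeriv_comm 1 0 (contDiff_partialDeriv hl 0)
  have cl1 := partialDeriv_comm 1 0 (contDiff_partialDeriv hl 1)
  have ca1 := partialDeriv_comm 1 0 (contDiff_partialDeriv ha 1)
  unfold planeLaplacian conformalDiv
  simp (disch := fun_prop) only [h0, h1, partialDeriv_add, partialDeriv_mul, partialDeriv_const,
    partialDeriv_neg, partialDeriv_exp, partialDeriv_sub, cl, ca, cl0, cl1, ca1, hl11, ha11]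
  ring

/-- The vector field whose divergence is `e^{2(f+l)} X(k)`, where `k` is the curvature of
`e^{2(f+l)} |dy|²` and `X = (a, b)` is conformal; `(c, i)` is `(a, 0)` or `(b, 1)`. -/
def kazdanWarnerFlux (f l a b c : EuclideanSpace ℝ (Fin 2) → ℝ) (i : Fin 2)
    (y : EuclideanSpace ℝ (Fin 2)) : ℝ :=
  (Real.exp (2 * l y) - planeLaplacian f y) * c y - (1 + 2 * f y) * Real.exp (2 * l y) * c y
    + conformalDiv l a b y * partialDeriv i f y - f y * partialDeriv i (conformalDiv l a b) y
    + 2 * (a y * partialDeriv 0 f y + b y * partialDeriv 1 f y) * partialDeriv i f y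
    - (partialDeriv 0 f y ^ 2 + partialDeriv 1 f y ^ 2) * c y

theorem contDiff_kazdanWarnerFlux {c : EuclideanSpace ℝ (Fin 2) → ℝ} (hf : ContDiff ℝ ∞ f)
    (hl : ContDiff ℝ ∞ l) (ha : ContDiff ℝ ∞ a) (hb : ContDiff ℝ ∞ b) (hc : ContDiff ℝ ∞ c)
    (i : Fin 2) : ContDiff ℝ ∞ (kazdanWarnerFlux f l a b c i) := by
  unfold kazdanWarnerFlux
  fun_prop

/-- Write `w = e^{2l} - Δf = e^{2(f+l)} k`. The left factor times `X(k)` is `div(wX) - w(Ω +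
2X(f))`, so the second term has to be a divergence too. Green's field `Ω∇f - f∇Ω` has divergence
`ΩΔf + 2f e^{2l}Ω`, by the equation for `ΔΩ`; the field `-(1 + 2f) e^{2l} X` removes the excess and
supplies the `e^{2l}` terms. The Pohozaev field `2X(f)∇f - |∇f|² X` has divergence `2X(f)Δf` because
`X` is conformal. -/
theorem div_kazdanWarnerFlux (hf : ContDiff ℝ ∞ f) (hl : ContDiff ℝ ∞ l) (ha : ContDiff ℝ ∞ a)
    (hb : ContDiff ℝ ∞ b) (h0 : partialDeriv 0 b = fun y ↦ -partialDeriv 1 a y)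
    (h1 : partialDeriv 1 b = partialDeriv 0 a)
    (hlap : ∀ y, planeLaplacian l y = -Real.exp (2 * l y)) {k : EuclideanSpace ℝ (Fin 2) → ℝ}
    (hk : k = fun y ↦ -Real.exp (-(2 * (f y + l y))) * planeLaplacian (fun z ↦ f z + l z) y)
    (y : EuclideanSpace ℝ (Fin 2)) :
    partialDeriv 0 (kazdanWarnerFlux f l a b a 0) y + partialDeriv 1 (kazdanWarnerFlux f l a b b 1) y
      = Real.exp (2 * (f y + l y)) * (a y * partialDeriv 0 k y + b y * partialDeriv 1 k y) := by
  have hw : k = fun y ↦ Real.exp (-(2 * (f y + l y))) *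
      (Real.exp (2 * l y) - planeLaplacian f y) := by
    rw [hk]
    funext y
    have : planeLaplacian (fun z ↦ f z + l z) y = planeLaplacian f y + planeLaplacian l y := by
      unfold planeLaplacian
      simp (disch := fun_prop) only [partialDeriv_add]
      ring
    rw [this, hlap]
    ring
  have he : Real.exp (2 * (f y + l y)) * Real.exp (-(2 * (f y + l y))) = 1 := by
    rw [← Real.exp_add]; simp
  have hΩ := planeLaplacian_conformalDiv hl ha hb h0 h1 hlap y
  -- `Ω` and `D = Δf` are made opaque so that they are differentiated as single functions; only the
  -- equation for `ΔΩ` and the value `hΩy` are needed.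
  obtain ⟨Ω, hΩd⟩ : ∃ Ω, Ω = conformalDiv l a b := ⟨_, rfl⟩
  have hΩs : ContDiff ℝ ∞ Ω := hΩd ▸ contDiff_conformalDiv hl ha hb
  have hΩy : Ω y = partialDeriv 0 a y + partialDeriv 0 a y +
      2 * (a y * partialDeriv 0 l y + b y * partialDeriv 1 l y) := by
    rw [hΩd, conformalDiv, h1]
  obtain ⟨D, hD⟩ : ∃ D, D = planeLaplacian f := ⟨_, rfl⟩
  have hDs : ContDiff ℝ ∞ D := hD ▸ contDiff_planeLaplacian hf
  have hf11 : partialDeriv 1 (partialDeriv 1 f) =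
      fun y ↦ D y - partialDeriv 0 (partialDeriv 0 f) y := by
    funext y; rw [hD, planeLaplacian]; ring
  have cf := partialDeriv_comm 1 0 hf
  unfold kazdanWarnerFlux
  rw [← hΩd] at hΩ ⊢
  rw [hw, ← hD]
  unfold planeLaplacian at hΩ
  simp (disch := fun_prop) only [h0, h1, partialDeriv_add, partialDeriv_mul, partialDeriv_const,
    partialDeriv_neg, partialDeriv_exp, partialDeriv_sub, partialDeriv_pow_two, cf, hf11]
  linear_combination (-f y) * hΩ + (D y + 2 * f y * Real.exp (2 * l y)) * hΩy
    - (a y * (2 * partialDeriv 0 l y * Real.exp (2 * l y) - partialDeriv 0 D y)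
      + b y * (2 * partialDeriv 1 l y * Real.exp (2 * l y) - partialDeriv 1 D y)
      - 2 * (a y * (partialDeriv 0 f y + partialDeriv 0 l y)
        + b y * (partialDeriv 1 f y + partialDeriv 1 l y)) * (Real.exp (2 * l y) - D y)) * he

end PlaneConformal

/-! ## A divergence theorem in the plane -/

section PlaneDivergence

open Filter Topology

theorem integrable_inv_one_add_norm_pow_three :
    Integrable (fun y : EuclideanSpace ℝ (Fin 2) ↦ ((1 + ‖y‖) ^ 3)⁻¹) := by
  have h := integrable_one_add_norm (E := EuclideanSpace ℝ (Fin 2))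
    (μ := volume) (r := 3) (by simp; norm_num)
  refine h.congr (Filter.Eventually.of_forall fun y ↦ ?_)
  simp only
  rw [Real.rpow_neg (by positivity)]
  norm_cast

/-- A smooth cutoff of the plane, equal to `1` on the ball of radius `n + 1`. -/
def planeCutoff (n : ℕ) (y : EuclideanSpace ℝ (Fin 2)) : ℝ :=
  (⟨1, 2, one_pos, one_lt_two⟩ : ContDiffBump (0 : EuclideanSpace ℝ (Fin 2))) (((n : ℝ) + 1)⁻¹ • y)

theorem contDiff_planeCutoff (n : ℕ) : ContDiff ℝ ∞ (planeCutoff n) :=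
  (ContDiffBump.contDiff _).comp (contDiff_const_smul _)

theorem hasCompactSupport_planeCutoff (n : ℕ) : HasCompactSupport (planeCutoff n) :=
  (ContDiffBump.hasCompactSupport _).comp_smul (by positivity)

theorem abs_planeCutoff_le (n : ℕ) (y : EuclideanSpace ℝ (Fin 2)) : |planeCutoff n y| ≤ 1 := by
  rw [planeCutoff, abs_of_nonneg (ContDiffBump.nonneg _)]
  exact ContDiffBump.le_one _

theorem planeCutoff_eq_one {n : ℕ} {y : EuclideanSpace ℝ (Fin 2)} (h : ‖y‖ ≤ n + 1) :
    planeCutoff n y = 1 := by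
  apply ContDiffBump.one_of_mem_closedBall
  rw [mem_closedBall_zero_iff, norm_smul, norm_inv, Real.norm_of_nonneg (by positivity)]
  exact (inv_mul_le_one₀ (by positivity)).2 h

/-- The first bound gives pointwise convergence to zero, the second a domination uniform in `n`. The
second follows from the first because the gradient is supported in `‖y‖ ≤ 2(n + 1)`. -/
theorem exists_norm_fderiv_planeCutoff_le : ∃ C, 0 ≤ C ∧ ∀ n y,
    ‖fderiv ℝ (planeCutoff n) y‖ ≤ C / (n + 1) ∧ ‖fderiv ℝ (planeCutoff n) y‖ ≤ C / (1 + ‖y‖) := by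
  let χ : ContDiffBump (0 : EuclideanSpace ℝ (Fin 2)) := ⟨1, 2, one_pos, one_lt_two⟩
  have hχ : ContDiff ℝ ∞ χ := χ.contDiff
  obtain ⟨C, hC⟩ := (χ.hasCompactSupport.fderiv ℝ).exists_bound_of_continuous
    (hχ.continuous_fderiv (by simp))
  have hC0 : 0 ≤ C := (norm_nonneg _).trans (hC 0)
  have hd : ∀ n y, fderiv ℝ (planeCutoff n) y =
      ((n : ℝ) + 1)⁻¹ • fderiv ℝ χ (((n : ℝ) + 1)⁻¹ • y) := fun n y ↦
    fderiv_comp_smul (f := χ) (c := ((n : ℝ) + 1)⁻¹)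
  have h1 : ∀ n y, ‖fderiv ℝ (planeCutoff n) y‖ ≤ C / (n + 1) := fun n y ↦ by
    rw [hd, norm_smul, norm_inv, Real.norm_of_nonneg (by positivity), div_eq_inv_mul]
    gcongr
    exact hC _
  -- On the support, `1 + ‖y‖ ≤ 3(n + 1)`; this is the factor 3.
  refine ⟨3 * C, by positivity, fun n y ↦ ⟨(h1 n y).trans ?_, ?_⟩⟩
  · gcongr; linarith
  · by_cases hy : ‖y‖ ≤ 2 * (n + 1)
    · refine (h1 n y).trans ?_
      rw [div_le_div_iff₀ (by positivity) (by positivity)]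
      have : (0 : ℝ) ≤ n := n.cast_nonneg
      nlinarith
    · have : fderiv ℝ χ (((n : ℝ) + 1)⁻¹ • y) = 0 := by
        by_contra h
        have hs := support_fderiv_subset ℝ (f := χ) (Function.mem_support.2 h)
        rw [χ.tsupport_eq, mem_closedBall_zero_iff, norm_smul, norm_inv,
          Real.norm_of_nonneg (by positivity), inv_mul_le_iff₀ (by positivity)] at hs
        apply hy
        have : χ.rOut = 2 := rfl
        rw [this] at hs
        linarith
      rw [hd, this]
      simp
      positivity

theorem integral_planeCutoff_mul_partialDeriv {V : EuclideanSpace ℝ (Fin 2) → ℝ}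
    (hV : ContDiff ℝ ∞ V) (n : ℕ) (i : Fin 2) :
    Integrable (fun y ↦ planeCutoff n y * partialDeriv i V y) ∧
    ∫ y, planeCutoff n y * partialDeriv i V y = -∫ y, partialDeriv i (planeCutoff n) y * V y := by
  have hc := contDiff_planeCutoff n
  have hs := hasCompactSupport_planeCutoff n
  have hd : Continuous (partialDeriv i V) := (contDiff_partialDeriv hV i).continuous
  have hdc : Continuous (partialDeriv i (planeCutoff n)) := (contDiff_partialDeriv hc i).continuous
  have hds : HasCompactSupport (partialDeriv i (planeCutoff n)) := hs.fderiv_apply ℝ _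
  have hi : Integrable (fun y ↦ planeCutoff n y * partialDeriv i V y) :=
    (hc.continuous.mul hd).integrable_of_hasCompactSupport hs.mul_right
  refine ⟨hi, ?_⟩
  exact integral_mul_fderiv_eq_neg_fderiv_mul_of_integrable
    ((hdc.mul hV.continuous).integrable_of_hasCompactSupport hds.mul_right) hi
    ((hc.continuous.mul hV.continuous).integrable_of_hasCompactSupport hs.mul_right)
    (fun y _ ↦ differentiable_of_smooth hc y) (fun y _ ↦ differentiable_of_smooth hV y)

/-- Quadratic decay is enough: the cutoff gradient contributes one more power, and `(1 + ‖y‖)^{-3}`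
is integrable in the plane. -/
theorem tendsto_integral_partialDeriv_planeCutoff_mul {V : EuclideanSpace ℝ (Fin 2) → ℝ} {C : ℝ}
    (hV : Continuous V) (hVC : ∀ y, |V y| ≤ C / (1 + ‖y‖) ^ 2) (i : Fin 2) :
    Tendsto (fun n ↦ ∫ y, partialDeriv i (planeCutoff n) y * V y) atTop (𝓝 0) := by
  obtain ⟨B, hB0, hB⟩ := exists_norm_fderiv_planeCutoff_le
  have hle : ∀ n y, |partialDeriv i (planeCutoff n) y| ≤ ‖fderiv ℝ (planeCutoff n) y‖ := by
    intro n y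
    refine ((fderiv ℝ (planeCutoff n) y).le_opNorm _).trans ?_
    simp
  rw [← integral_zero (EuclideanSpace ℝ (Fin 2)) ℝ (μ := volume)]
  refine tendsto_integral_of_dominated_convergence
    (fun y ↦ (B * C) * ((1 + ‖y‖) ^ 3)⁻¹) (fun n ↦ ?_)
    (integrable_inv_one_add_norm_pow_three.const_mul _) (fun n ↦ ?_) ?_
  · exact ((contDiff_partialDeriv (contDiff_planeCutoff n) i).continuous.mul
      hV).aestronglyMeasurable
  · refine Filter.Eventually.of_forall fun y ↦ ?_
    rw [norm_mul, Real.norm_eq_abs, Real.norm_eq_abs]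
    calc _ ≤ (B / (1 + ‖y‖)) * (C / (1 + ‖y‖) ^ 2) := by
          gcongr
          · exact (hle n y).trans (hB n y).2
          · exact hVC y
      _ = _ := by field_simp
  · refine Filter.Eventually.of_forall fun y ↦ ?_
    refine squeeze_zero_norm (a := fun n : ℕ ↦ B / (n + 1) * |V y|) (fun n ↦ ?_) ?_
    · rw [norm_mul, Real.norm_eq_abs, Real.norm_eq_abs]
      gcongr
      exact (hle n y).trans (hB n y).1
    · have h := (tendsto_one_div_add_atTop_nhds_zero_nat (𝕜 := ℝ)).const_mul B
      simpa [div_eq_mul_inv] using h.mul_const |V y|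

/-- The integral of the divergence of a plane vector field which decays quadratically vanishes. -/
theorem integral_div_eq_zero {V W : EuclideanSpace ℝ (Fin 2) → ℝ} {C : ℝ} (hV : ContDiff ℝ ∞ V)
    (hW : ContDiff ℝ ∞ W) (hVC : ∀ y, |V y| ≤ C / (1 + ‖y‖) ^ 2)
    (hWC : ∀ y, |W y| ≤ C / (1 + ‖y‖) ^ 2)
    (hi : Integrable fun y ↦ partialDeriv 0 V y + partialDeriv 1 W y) :
    ∫ y, (partialDeriv 0 V y + partialDeriv 1 W y) = 0 := by
  have h1 : Tendsto (fun n ↦ ∫ y, planeCutoff n y * (partialDeriv 0 V y + partialDeriv 1 W y)) atTop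
      (𝓝 (∫ y, (partialDeriv 0 V y + partialDeriv 1 W y))) := by
    refine tendsto_integral_of_dominated_convergence _ (fun n ↦ ?_) hi.norm (fun n ↦ ?_) ?_
    · exact (contDiff_planeCutoff n).continuous.aestronglyMeasurable.mul hi.aestronglyMeasurable
    · refine Filter.Eventually.of_forall fun y ↦ ?_
      rw [norm_mul]
      exact mul_le_of_le_one_left (norm_nonneg _) (abs_planeCutoff_le n y)
    · refine Filter.Eventually.of_forall fun y ↦ tendsto_const_nhds.congr' ?_
      obtain ⟨N, hN⟩ := exists_nat_ge ‖y‖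
      filter_upwards [eventually_ge_atTop N] with n hn
      rw [planeCutoff_eq_one, one_mul]
      have : (N : ℝ) ≤ n := by exact_mod_cast hn
      linarith
  have h2 : Tendsto (fun n ↦ ∫ y, planeCutoff n y * (partialDeriv 0 V y + partialDeriv 1 W y)) atTop
      (𝓝 0) := by
    have h := (tendsto_integral_partialDeriv_planeCutoff_mul hV.continuous hVC 0).neg.add
      (tendsto_integral_partialDeriv_planeCutoff_mul hW.continuous hWC 1).neg
    simp only [neg_zero, add_zero] at h
    refine h.congr fun n ↦ ?_
    obtain ⟨i1, e1⟩ := integral_planeCutoff_mul_partialDeriv hV n 0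
    obtain ⟨i2, e2⟩ := integral_planeCutoff_mul_partialDeriv hW n 1
    rw [← e1, ← e2, ← integral_add i1 i2]
    simp only [mul_add]
  exact tendsto_nhds_unique h1 h2

end PlaneDivergence

/-! ## Stereographic charts -/

section Stereographic

/-- The inverse of the preferred chart at `p`: inverse stereographic projection from `-p`. -/
def stereoParam (p : S2) : EuclideanSpace ℝ (Fin 2) → S2 :=
  (chartAt (EuclideanSpace ℝ (Fin 2)) p).symm

/-- The isometric identification of the plane with the orthogonal complement of `p` which is used by
the preferred chart at `p`. -/
def stereoFrame (p : S2) : EuclideanSpace ℝ (Fin 2) →ₗᵢ[ℝ] EuclideanSpace ℝ (Fin 3) :=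
  have : Fact (Module.finrank ℝ (EuclideanSpace ℝ (Fin 3)) = 2 + 1) := ⟨by simp⟩
  (Submodule.subtypeₗᵢ _).comp (OrthonormalBasis.fromOrthogonalSpanSingleton (𝕜 := ℝ) 2
    (ne_zero_of_mem_unit_sphere (-p))).repr.symm.toLinearIsometry

theorem inner_stereoFrame_self (p : S2) (v : EuclideanSpace ℝ (Fin 2)) :
    inner ℝ (stereoFrame p v) (p : EuclideanSpace ℝ (Fin 3)) = 0 := by
  have : Fact (Module.finrank ℝ (EuclideanSpace ℝ (Fin 3)) = 2 + 1) := ⟨by simp⟩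
  have h := Submodule.mem_orthogonal_singleton_iff_inner_left.1
    ((OrthonormalBasis.fromOrthogonalSpanSingleton (𝕜 := ℝ) 2
    (ne_zero_of_mem_unit_sphere (-p))).repr.symm v).2
  have h2 : inner ℝ (stereoFrame p v) (-(p : EuclideanSpace ℝ (Fin 3))) = 0 := h
  simpa using h2

theorem coe_stereoParam (p : S2) (y : EuclideanSpace ℝ (Fin 2)) :
    (stereoParam p y : EuclideanSpace ℝ (Fin 3)) =
      (‖y‖ ^ 2 + 4)⁻¹ • ((4 : ℝ) • stereoFrame p y - (‖y‖ ^ 2 - 4) • (p : EuclideanSpace ℝ (Fin 3))) := by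
  have : Fact (Module.finrank ℝ (EuclideanSpace ℝ (Fin 3)) = 2 + 1) := ⟨by simp⟩
  have h := stereographic'_symm_apply (n := 2) (-p) y
  refine h.trans ?_
  simp only [LinearIsometryEquiv.norm_map, ← Submodule.coe_norm]
  rw [← smul_add, sub_eq_add_neg ((4 : ℝ) • stereoFrame p y), ← smul_neg]
  rfl

theorem chart_source (p : S2) : (chartAt (EuclideanSpace ℝ (Fin 2)) p).source = {-p}ᶜ :=
  have : Fact (Module.finrank ℝ (EuclideanSpace ℝ (Fin 3)) = 2 + 1) := ⟨by simp⟩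
  stereographic'_source (n := 2) (-p)

theorem chart_target (p : S2) : (chartAt (EuclideanSpace ℝ (Fin 2)) p).target = univ :=
  have : Fact (Module.finrank ℝ (EuclideanSpace ℝ (Fin 3)) = 2 + 1) := ⟨by simp⟩
  stereographic'_target (n := 2) (-p)

theorem chart_stereoParam (p : S2) (y : EuclideanSpace ℝ (Fin 2)) :
    chartAt (EuclideanSpace ℝ (Fin 2)) p (stereoParam p y) = y :=
  (chartAt (EuclideanSpace ℝ (Fin 2)) p).right_inv (by rw [chart_target]; trivial)

theorem stereoParam_chart {p q : S2} (h : q ∈ (chartAt (EuclideanSpace ℝ (Fin 2)) p).source) :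
    stereoParam p (chartAt (EuclideanSpace ℝ (Fin 2)) p q) = q :=
  (chartAt (EuclideanSpace ℝ (Fin 2)) p).left_inv h

theorem stereoParam_injective (p : S2) : Function.Injective (stereoParam p) :=
  Function.LeftInverse.injective (chart_stereoParam p)

theorem contMDiff_stereoParam (p : S2) : ContMDiff (𝓡 2) (𝓡 2) ∞ (stereoParam p) := by
  have h := contMDiffOn_chart_symm (I := 𝓡 2) (n := ∞) (H := EuclideanSpace ℝ (Fin 2)) (x := p)
  rw [chart_target, contMDiffOn_univ] at h
  exact h

theorem mdifferentiable_stereoParam (p : S2) : MDifferentiable (𝓡 2) (𝓡 2) (stereoParam p) :=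
  (contMDiff_stereoParam p).mdifferentiable (by simp)

theorem continuous_stereoParam (p : S2) : Continuous (stereoParam p) :=
  (contMDiff_stereoParam p).continuous

/-- The logarithm of the conformal factor of inverse stereographic projection. -/
def logConfFactor (y : EuclideanSpace ℝ (Fin 2)) : ℝ := Real.log (4 / (‖y‖ ^ 2 + 4))

theorem exp_logConfFactor (y : EuclideanSpace ℝ (Fin 2)) :
    Real.exp (logConfFactor y) = 4 / (‖y‖ ^ 2 + 4) :=
  Real.exp_log (by positivity)

theorem exp_two_mul_logConfFactor (y : EuclideanSpace ℝ (Fin 2)) :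
    Real.exp (2 * logConfFactor y) = 16 / (‖y‖ ^ 2 + 4) ^ 2 := by
  rw [two_mul, Real.exp_add, exp_logConfFactor]
  field_simp
  norm_num

theorem norm_sq_eq (y : EuclideanSpace ℝ (Fin 2)) : ‖y‖ ^ 2 = y 0 * y 0 + y 1 * y 1 := by
  rw [EuclideanSpace.real_norm_sq_eq]
  simp [pow_two]

@[fun_prop]
theorem contDiff_coord {n : ℕ} (j : Fin n) :
    ContDiff ℝ ∞ (fun y : EuclideanSpace ℝ (Fin n) ↦ y j) := by
  fun_prop

theorem partialDeriv_coord {n : ℕ} (i j : Fin n) :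
    partialDeriv i (fun y : EuclideanSpace ℝ (Fin n) ↦ y j) = fun _ ↦ if j = i then 1 else 0 := by
  funext y
  have : (fun y : EuclideanSpace ℝ (Fin n) ↦ y j) = EuclideanSpace.proj (𝕜 := ℝ) j := rfl
  rw [partialDeriv, this, ContinuousLinearMap.fderiv]
  simp

theorem contDiff_logConfFactor : ContDiff ℝ ∞ logConfFactor := by
  unfold logConfFactor
  apply ContDiff.log
  · exact contDiff_const.div ((contDiff_norm_sq ℝ).add contDiff_const) fun y ↦ by positivity
  · intro y; positivity

theorem partialDeriv_logConfFactor (i : Fin 2) :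
    partialDeriv i logConfFactor = fun y ↦ -(1 / 2) * (Real.exp (logConfFactor y) * y i) := by
  -- Differentiating `e^l (|y|² + 4) = 4` avoids differentiating the logarithm.
  have h : (fun y ↦ Real.exp (logConfFactor y) * (y 0 * y 0 + y 1 * y 1 + 4)) = fun _ ↦ 4 := by
    funext y
    rw [exp_logConfFactor, ← norm_sq_eq]
    field_simp
  have hd := congrArg (partialDeriv i) h
  have hl := contDiff_logConfFactor
  funext y
  have hy := congrFun hd y
  simp (disch := fun_prop) only [partialDeriv_mul, partialDeriv_exp, partialDeriv_add,
    partialDeriv_const, partialDeriv_coord] at hy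
  have hy2 := congrFun h y
  simp only at hy2
  fin_cases i <;> simp at hy ⊢
  · linear_combination (1 / 4) * hy - (1 / 4) * partialDeriv 0 logConfFactor y * hy2
  · linear_combination (1 / 4) * hy - (1 / 4) * partialDeriv 1 logConfFactor y * hy2

theorem planeLaplacian_logConfFactor (y : EuclideanSpace ℝ (Fin 2)) :
    planeLaplacian logConfFactor y = -Real.exp (2 * logConfFactor y) := by
  have hl := contDiff_logConfFactor
  unfold planeLaplacian
  simp (disch := fun_prop) only [partialDeriv_logConfFactor, partialDeriv_mul, partialDeriv_exp,
    partialDeriv_const, partialDeriv_coord]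
  rw [two_mul, Real.exp_add, exp_logConfFactor]
  have h := norm_sq_eq y
  have : ‖y‖ ^ 2 + 4 ≠ 0 := by positivity
  simp
  field_simp
  rw [h]
  ring

/-- The differential of inverse stereographic projection, as a map into `ℝ³`. -/
def stereoDeriv (p : S2) (y v : EuclideanSpace ℝ (Fin 2)) : EuclideanSpace ℝ (Fin 3) :=
  fderiv ℝ (fun z ↦ (stereoParam p z : EuclideanSpace ℝ (Fin 3))) y v

theorem contDiff_coe_stereoParam (p : S2) :
    ContDiff ℝ ∞ (fun z ↦ (stereoParam p z : EuclideanSpace ℝ (Fin 3))) := by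
  simp only [coe_stereoParam]
  apply ContDiff.fun_smul
  · exact ((contDiff_norm_sq ℝ).add contDiff_const).inv fun y ↦ by positivity
  · exact ((stereoFrame p).contDiff.const_smul (4 : ℝ)).sub
      (((contDiff_norm_sq ℝ).sub contDiff_const).smul contDiff_const)

theorem stereoDeriv_eq (p : S2) (y v : EuclideanSpace ℝ (Fin 2)) :
    stereoDeriv p y v = (‖y‖ ^ 2 + 4)⁻¹ • ((4 : ℝ) • stereoFrame p v
      - (2 * inner ℝ y v) • (p : EuclideanSpace ℝ (Fin 3)))
      - ((‖y‖ ^ 2 + 4) ^ 2)⁻¹ • (2 * inner ℝ y v) •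
        ((4 : ℝ) • stereoFrame p y - (‖y‖ ^ 2 - 4) • (p : EuclideanSpace ℝ (Fin 3))) := by
  have h1 : HasFDerivAt (fun z : EuclideanSpace ℝ (Fin 2) ↦ ‖z‖ ^ 2) (2 • innerSL ℝ y) y :=
    (hasStrictFDerivAt_norm_sq y).hasFDerivAt
  have h2 : HasFDerivAt (fun z ↦ stereoFrame p z) (stereoFrame p).toContinuousLinearMap y :=
    (stereoFrame p).toContinuousLinearMap.hasFDerivAt
  have h3 := (HasFDerivAt.comp y (hasDerivAt_inv (x := ‖y‖ ^ 2 + 4) (by positivity)).hasFDerivAt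
    (h1.add_const 4)).smul
    ((h2.const_smul (4 : ℝ)).sub ((h1.sub_const 4).smul_const (p : EuclideanSpace ℝ (Fin 3))))
  have h4 : (fun z ↦ (stereoParam p z : EuclideanSpace ℝ (Fin 3))) = fun z ↦
      (‖z‖ ^ 2 + 4)⁻¹ • ((4 : ℝ) • stereoFrame p z - (‖z‖ ^ 2 - 4) • (p : EuclideanSpace ℝ (Fin 3))) :=
    funext fun z ↦ coe_stereoParam p z
  have h5 := h3.fderiv
  rw [stereoDeriv, h4]
  refine (congrArg (fun L ↦ L v) h5).trans ?_
  simp [smul_smul]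
  module

/-- Conformality of stereographic projection: the frame is isometric and orthogonal to the unit
vector `p`, so expanding the explicit differential leaves only a multiple of `⟨v, w⟩`. -/
theorem inner_stereoDeriv (p : S2) (y v w : EuclideanSpace ℝ (Fin 2)) :
    inner ℝ (stereoDeriv p y v) (stereoDeriv p y w) =
      Real.exp (2 * logConfFactor y) * inner ℝ v w := by
  have hp : inner ℝ (p : EuclideanSpace ℝ (Fin 3)) (p : EuclideanSpace ℝ (Fin 3)) = (1 : ℝ) := by
    rw [real_inner_self_eq_norm_sq, norm_eq_of_mem_sphere]; norm_num
  have hf := inner_stereoFrame_self p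
  have hf' : ∀ v, inner ℝ (p : EuclideanSpace ℝ (Fin 3)) (stereoFrame p v) = 0 := fun v ↦ by
    rw [real_inner_comm, hf]
  have hy : inner ℝ y y = ‖y‖ ^ 2 := real_inner_self_eq_norm_sq y
  rw [stereoDeriv_eq, stereoDeriv_eq, exp_two_mul_logConfFactor]
  simp only [inner_sub_left, inner_sub_right, real_inner_smul_left, real_inner_smul_right, hp, hf,
    hf', LinearIsometry.inner_map_map, hy, real_inner_comm y v]
  field_simp
  ring

end Stereographic

/-! ## Functions, vector fields and metrics in stereographic charts -/

section ChartExpressions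

/-- Each chart has the whole plane as target, so smoothness on the sphere can be tested by globally
smooth functions of the plane. -/
theorem contMDiff_iff_comp_stereoParam {h : S2 → ℝ} :
    ContMDiff (𝓡 2) 𝓘(ℝ, ℝ) ∞ h ↔ ∀ p, ContDiff ℝ ∞ fun y ↦ h (stereoParam p y) := by
  refine ⟨fun hh p ↦ contMDiff_iff_contDiff.1 (hh.comp (contMDiff_stereoParam p)), fun hh p ↦ ?_⟩
  have h1 : ContMDiffAt (𝓡 2) (𝓡 2) ∞ (chartAt (EuclideanSpace ℝ (Fin 2)) p) p :=
    contMDiffAt_of_mem_maximalAtlas (IsManifold.chart_mem_maximalAtlas p) (mem_chart_source _ p)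
  have h2 : ContMDiffAt (𝓡 2) 𝓘(ℝ, ℝ) ∞ (fun y ↦ h (stereoParam p y))
      (chartAt (EuclideanSpace ℝ (Fin 2)) p p) := (hh p).contMDiff.contMDiffAt
  refine (h2.comp p h1).congr_of_eventuallyEq ?_
  filter_upwards [(chartAt (EuclideanSpace ℝ (Fin 2)) p).open_source.mem_nhds
    (mem_chart_source _ p)] with q hq
  simp [stereoParam_chart hq]

theorem isInvertible_mfderiv_stereoParam (p : S2) (y : EuclideanSpace ℝ (Fin 2)) :
    (mfderiv (𝓡 2) (𝓡 2) (stereoParam p) y).IsInvertible :=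
  ⟨(mdifferentiable_chart (I := 𝓡 2) p).symm.mfderiv
    (x := y) (by rw [OpenPartialHomeomorph.symm_source, chart_target]; trivial), rfl⟩

theorem isInvertible_mfderiv_chart {p q : S2}
    (hq : q ∈ (chartAt (EuclideanSpace ℝ (Fin 2)) p).source) :
    (mfderiv (𝓡 2) (𝓡 2) (chartAt (EuclideanSpace ℝ (Fin 2)) p) q).IsInvertible :=
  ⟨(mdifferentiable_chart (I := 𝓡 2) p).mfderiv hq, rfl⟩

/-- The expression of a vector field of the sphere in the preferred chart at `p`. -/
def chartField (p : S2) (X : (q : S2) → TangentSpace (𝓡 2) q) (y : EuclideanSpace ℝ (Fin 2)) :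
    EuclideanSpace ℝ (Fin 2) :=
  VectorField.mpullback (𝓡 2) (𝓡 2) (stereoParam p) X y

theorem mfderiv_chartField (p : S2) (X : (q : S2) → TangentSpace (𝓡 2) q)
    (y : EuclideanSpace ℝ (Fin 2)) :
    mfderiv (𝓡 2) (𝓡 2) (stereoParam p) y (chartField p X y) = X (stereoParam p y) := by
  obtain ⟨e, he⟩ := isInvertible_mfderiv_stereoParam p y
  rw [chartField, VectorField.mpullback_apply, ← he, ContinuousLinearMap.inverse_equiv]
  exact e.apply_symm_apply _

theorem mfderiv_chart_stereoParam (p : S2) (X : (q : S2) → TangentSpace (𝓡 2) q)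
    (y : EuclideanSpace ℝ (Fin 2)) :
    mfderiv (𝓡 2) (𝓡 2) (chartAt (EuclideanSpace ℝ (Fin 2)) p) (stereoParam p y)
      (X (stereoParam p y)) = chartField p X y := by
  have hc := (mdifferentiable_chart (I := 𝓡 2) p).comp_symm_deriv
    (x := y) (by rw [chart_target]; trivial)
  rw [← mfderiv_chartField p X y]
  exact congrArg (fun L ↦ L (chartField p X y)) hc

theorem inclDeriv_mfderiv (p : S2) (y v : EuclideanSpace ℝ (Fin 2)) :
    inclDeriv (stereoParam p y) (mfderiv (𝓡 2) (𝓡 2) (stereoParam p) y v) = stereoDeriv p y v := by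
  have : Fact (Module.finrank ℝ (EuclideanSpace ℝ (Fin 3)) = 2 + 1) := ⟨by simp⟩
  have h1 : MDifferentiableAt (𝓡 2) 𝓘(ℝ, EuclideanSpace ℝ (Fin 3))
      (fun q : S2 ↦ (q : EuclideanSpace ℝ (Fin 3))) (stereoParam p y) :=
    (contMDiff_coe_sphere (m := ∞) (n := 2)).mdifferentiable (by simp) _
  have h2 := mfderiv_comp_apply (I := 𝓡 2) y h1 (mdifferentiable_stereoParam p y) v
  rw [mfderiv_eq_fderiv] at h2
  refine h2.symm.trans ?_
  rfl

theorem roundInner_mfderiv (p : S2) (y v w : EuclideanSpace ℝ (Fin 2)) :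
    roundInner (stereoParam p y) (mfderiv (𝓡 2) (𝓡 2) (stereoParam p) y v)
      (mfderiv (𝓡 2) (𝓡 2) (stereoParam p) y w) = Real.exp (2 * logConfFactor y) * inner ℝ v w := by
  rw [roundInner_apply, inclDeriv_mfderiv, inclDeriv_mfderiv, inner_stereoDeriv]

theorem roundInner_chartField (p : S2) (X Y : (q : S2) → TangentSpace (𝓡 2) q)
    (y : EuclideanSpace ℝ (Fin 2)) :
    roundInner (stereoParam p y) (X (stereoParam p y)) (Y (stereoParam p y)) =
      Real.exp (2 * logConfFactor y) * inner ℝ (chartField p X y) (chartField p Y y) := by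
  rw [← roundInner_mfderiv p, mfderiv_chartField, mfderiv_chartField]

theorem mvfderiv_mfderiv_stereoParam {h : S2 → ℝ} (hh : ContMDiff (𝓡 2) 𝓘(ℝ, ℝ) ∞ h) (p : S2)
    (y v : EuclideanSpace ℝ (Fin 2)) :
    mvfderiv (𝓡 2) h (stereoParam p y) (mfderiv (𝓡 2) (𝓡 2) (stereoParam p) y v) =
      fderiv ℝ (fun z ↦ h (stereoParam p z)) y v := by
  have h2 := mvfderiv_comp_apply (I := 𝓡 2) y (hh.mdifferentiable (by simp) _)
    (mdifferentiable_stereoParam p y) v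
  refine h2.symm.trans ?_
  rw [mvfderiv, mfderiv_eq_fderiv]
  rfl

theorem mvfderiv_chartField {h : S2 → ℝ} (hh : ContMDiff (𝓡 2) 𝓘(ℝ, ℝ) ∞ h) (p : S2)
    (X : (q : S2) → TangentSpace (𝓡 2) q) (y : EuclideanSpace ℝ (Fin 2)) :
    mvfderiv (𝓡 2) h (stereoParam p y) (X (stereoParam p y)) =
      fderiv ℝ (fun z ↦ h (stereoParam p z)) y (chartField p X y) := by
  rw [← mvfderiv_mfderiv_stereoParam hh, mfderiv_chartField]

theorem isSmoothVectorField_iff_chartField {X : (q : S2) → TangentSpace (𝓡 2) q} :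
    IsSmoothVectorField X ↔ ∀ p, ContDiff ℝ ∞ (chartField p X) := by
  constructor
  · intro hX p
    have h := ContMDiff.mpullback_vectorField (m := ∞) (n := ∞) hX (contMDiff_stereoParam p)
      (isInvertible_mfderiv_stereoParam p) (by simp)
    rw [contDiff_iff_contDiffAt]
    exact fun y ↦ contMDiffAt_vectorSpace_iff_contDiffAt.1 (h y)
  · intro hX p
    have hp := mem_chart_source (EuclideanSpace ℝ (Fin 2)) p
    have h1 : ContMDiffAt (𝓡 2) (𝓡 2) ∞ (chartAt (EuclideanSpace ℝ (Fin 2)) p) p :=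
      contMDiffAt_of_mem_maximalAtlas (IsManifold.chart_mem_maximalAtlas p) hp
    have h2 := ContMDiffAt.mpullback_vectorField_preimage (m := ∞) (n := ∞)
      (V := chartField p X)
      (contMDiffAt_vectorSpace_iff_contDiffAt.2 (hX p).contDiffAt) h1
      (isInvertible_mfderiv_chart hp) (by simp)
    refine h2.congr_of_eventuallyEq ?_
    filter_upwards [(chartAt (EuclideanSpace ℝ (Fin 2)) p).open_source.mem_nhds hp] with q hq
    obtain ⟨y, rfl⟩ : ∃ y, stereoParam p y = q := ⟨_, stereoParam_chart hq⟩
    obtain ⟨e, he⟩ := isInvertible_mfderiv_chart hq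
    have h3 : chartField p X (chartAt (EuclideanSpace ℝ (Fin 2)) p (stereoParam p y)) =
        e (X (stereoParam p y)) := by
      rw [chart_stereoParam, ← mfderiv_chart_stereoParam p X y, ← he]
      rfl
    refine congrArg (fun v ↦ (⟨stereoParam p y, v⟩ : TangentBundle (𝓡 2) S2)) ?_
    symm
    change (mfderiv (𝓡 2) (𝓡 2) (chartAt (EuclideanSpace ℝ (Fin 2)) p) (stereoParam p y)).inverse
      (chartField p X (chartAt (EuclideanSpace ℝ (Fin 2)) p (stereoParam p y))) = _
    rw [← he, ContinuousLinearMap.inverse_equiv, h3]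
    exact e.symm_apply_apply _

end ChartExpressions

/-! ## The Laplacian of the round sphere and the Gauss curvature -/

section SphereLaplacian

variable {f : S2 → ℝ} {g : SmoothMetric 2 S2}

theorem metric_mfderiv (hg : ∀ (p : S2) (v w : TangentSpace (𝓡 2) p),
      g.inner p v w = Real.exp (2 * f p) * roundMetric.inner p v w)
    (p : S2) (y v w : EuclideanSpace ℝ (Fin 2)) :
    g.inner (stereoParam p y) (mfderiv (𝓡 2) (𝓡 2) (stereoParam p) y v)
      (mfderiv (𝓡 2) (𝓡 2) (stereoParam p) y w) =
      Real.exp (2 * (f (stereoParam p y) + logConfFactor y)) * inner ℝ v w := by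
  rw [hg, mul_add, Real.exp_add, mul_assoc, ← roundInner_mfderiv p]
  rfl

theorem metricMatrix_eq (hg : ∀ (p : S2) (v w : TangentSpace (𝓡 2) p),
      g.inner p v w = Real.exp (2 * f p) * roundMetric.inner p v w) (p : S2) :
    metricMatrix g p = fun y ↦ Real.exp (2 * (f (stereoParam p y) + logConfFactor y)) •
      (1 : Matrix (Fin 2) (Fin 2) ℝ) := by
  funext y
  ext i j
  refine (metric_mfderiv hg p y _ _).trans ?_
  simp [Matrix.one_apply, EuclideanSpace.inner_single_left]

theorem chartField_metricGradient {h : S2 → ℝ} (hh : ContMDiff (𝓡 2) 𝓘(ℝ, ℝ) ∞ h) (p : S2)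
    (y : EuclideanSpace ℝ (Fin 2)) (i : Fin 2) :
    chartField p (metricGradient roundMetric h) y i =
      Real.exp (-(2 * logConfFactor y)) * partialDeriv i (fun z ↦ h (stereoParam p z)) y := by
  have h1 := inner_metricGradient roundMetric h (stereoParam p y)
    (mfderiv (𝓡 2) (𝓡 2) (stereoParam p) y (EuclideanSpace.single i (1 : ℝ)))
  rw [mvfderiv_mfderiv_stereoParam hh,
    ← mfderiv_chartField p (metricGradient roundMetric h)] at h1
  have h2 := (roundInner_mfderiv p y _ _).symm.trans h1
  rw [EuclideanSpace.inner_single_right] at h2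
  rw [partialDeriv, ← h2, ← mul_assoc, ← Real.exp_add]
  simp

theorem isSmoothVectorField_metricGradient {h : S2 → ℝ} (hh : ContMDiff (𝓡 2) 𝓘(ℝ, ℝ) ∞ h) :
    IsSmoothVectorField (metricGradient roundMetric h) := by
  rw [isSmoothVectorField_iff_chartField]
  intro p
  rw [contDiff_euclidean]
  intro i
  simp only [chartField_metricGradient hh]
  have h1 := contMDiff_iff_comp_stereoParam.1 hh p
  have h2 := contDiff_logConfFactor
  generalize (fun z ↦ h (stereoParam p z)) = a at h1 ⊢
  fun_prop

/-- The inner product of the gradients of two functions on the round sphere. -/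
def gradInner (h k : S2 → ℝ) (q : S2) : ℝ :=
  roundMetric.inner q (metricGradient roundMetric h q) (metricGradient roundMetric k q)

theorem gradInner_stereoParam {h k : S2 → ℝ} (hh : ContMDiff (𝓡 2) 𝓘(ℝ, ℝ) ∞ h)
    (hk : ContMDiff (𝓡 2) 𝓘(ℝ, ℝ) ∞ k) (p : S2) :
    (fun y ↦ gradInner h k (stereoParam p y)) = fun y ↦ Real.exp (-(2 * logConfFactor y)) *
      (partialDeriv 0 (fun z ↦ h (stereoParam p z)) y * partialDeriv 0 (fun z ↦ k (stereoParam p z)) y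
      + partialDeriv 1 (fun z ↦ h (stereoParam p z)) y *
        partialDeriv 1 (fun z ↦ k (stereoParam p z)) y) := by
  funext y
  refine (roundInner_chartField p _ _ y).trans ?_
  have he : Real.exp (-(2 * logConfFactor y)) * Real.exp (2 * logConfFactor y) = 1 := by
    rw [← Real.exp_add]; simp
  rw [PiLp.inner_apply, Fin.sum_univ_two]
  simp only [chartField_metricGradient hh, chartField_metricGradient hk, RCLike.inner_apply,
    conj_trivial]
  linear_combination Real.exp (-(2 * logConfFactor y)) *
    (partialDeriv 0 (fun z ↦ h (stereoParam p z)) y * partialDeriv 0 (fun z ↦ k (stereoParam p z)) y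
      + partialDeriv 1 (fun z ↦ h (stereoParam p z)) y *
        partialDeriv 1 (fun z ↦ k (stereoParam p z)) y) * he

theorem contMDiff_gradInner {h k : S2 → ℝ} (hh : ContMDiff (𝓡 2) 𝓘(ℝ, ℝ) ∞ h)
    (hk : ContMDiff (𝓡 2) 𝓘(ℝ, ℝ) ∞ k) : ContMDiff (𝓡 2) 𝓘(ℝ, ℝ) ∞ (gradInner h k) := by
  rw [contMDiff_iff_comp_stereoParam]
  intro p
  rw [gradInner_stereoParam hh hk]
  have h1 := contMDiff_iff_comp_stereoParam.1 hh p
  have h2 := contMDiff_iff_comp_stereoParam.1 hk p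
  have h3 := contDiff_logConfFactor
  generalize (fun z ↦ h (stereoParam p z)) = a at h1 ⊢
  generalize (fun z ↦ k (stereoParam p z)) = b at h2 ⊢
  fun_prop

theorem contMDiff_coordFun (i : Fin 3) : ContMDiff (𝓡 2) 𝓘(ℝ, ℝ) ∞ (coordFun i) := by
  rw [contMDiff_iff_comp_stereoParam]
  exact fun p ↦ (contDiff_coord i).comp (contDiff_coe_stereoParam p)

theorem partialDeriv_coordFun (p : S2) (i : Fin 3) (j : Fin 2) (y : EuclideanSpace ℝ (Fin 2)) :
    partialDeriv j (fun z ↦ coordFun i (stereoParam p z)) y =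
      stereoDeriv p y (EuclideanSpace.single j 1) i := by
  have h1 := (differentiable_of_smooth (n := 3) (contDiff_coord i)
    (stereoParam p y : EuclideanSpace ℝ (Fin 3))).hasFDerivAt.comp y
    ((contDiff_coe_stereoParam p).differentiable (by simp) y).hasFDerivAt
  have h2 : fderiv ℝ (fun x : EuclideanSpace ℝ (Fin 3) ↦ x i)
      (stereoParam p y : EuclideanSpace ℝ (Fin 3)) = EuclideanSpace.proj (𝕜 := ℝ) i :=
    (EuclideanSpace.proj (𝕜 := ℝ) i).fderiv
  rw [h2] at h1
  exact congrArg (fun L ↦ L (EuclideanSpace.single j 1)) h1.fderiv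

theorem sum_partialDeriv_coordFun (p : S2) (j k : Fin 2) (y : EuclideanSpace ℝ (Fin 2)) :
    ∑ i, partialDeriv j (fun z ↦ coordFun i (stereoParam p z)) y *
      partialDeriv k (fun z ↦ coordFun i (stereoParam p z)) y =
      if j = k then Real.exp (2 * logConfFactor y) else 0 := by
  have h := inner_stereoDeriv p y (EuclideanSpace.single j 1) (EuclideanSpace.single k 1)
  rw [PiLp.inner_apply] at h
  simp only [RCLike.inner_apply, conj_trivial, EuclideanSpace.inner_single_left] at h
  simp only [partialDeriv_coordFun, mul_comm (stereoDeriv p y (EuclideanSpace.single j 1) _)]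
  rw [h]
  simp

/-- The Laplacian of the round sphere, as the sum of the squares of the gradient fields of the
coordinate functions. -/
def sphereLaplacian (h : S2 → ℝ) (q : S2) : ℝ :=
  ∑ i, gradInner (coordFun i) (gradInner (coordFun i) h) q

theorem contMDiff_sphereLaplacian {h : S2 → ℝ} (hh : ContMDiff (𝓡 2) 𝓘(ℝ, ℝ) ∞ h) :
    ContMDiff (𝓡 2) 𝓘(ℝ, ℝ) ∞ (sphereLaplacian h) := by
  have h1 := fun i ↦ contMDiff_gradInner (contMDiff_coordFun i)
    (contMDiff_gradInner (contMDiff_coordFun i) hh)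
  unfold sphereLaplacian
  simp only [Fin.sum_univ_three]
  exact ((h1 0).add (h1 1)).add (h1 2)

theorem sphereLaplacian_stereoParam {h : S2 → ℝ} (hh : ContMDiff (𝓡 2) 𝓘(ℝ, ℝ) ∞ h) (p : S2)
    (y : EuclideanSpace ℝ (Fin 2)) :
    sphereLaplacian h (stereoParam p y) = Real.exp (-(2 * logConfFactor y)) *
      planeLaplacian (fun z ↦ h (stereoParam p z)) y := by
  have hl := contDiff_logConfFactor
  have key : ∀ (ξ : Fin 3 → EuclideanSpace ℝ (Fin 2) → ℝ) (k : EuclideanSpace ℝ (Fin 2) → ℝ),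
      (∀ i, ContDiff ℝ ∞ (ξ i)) → ContDiff ℝ ∞ k →
      (∀ i j y, ∑ m, partialDeriv i (ξ m) y * partialDeriv j (ξ m) y =
        if i = j then Real.exp (2 * logConfFactor y) else 0) →
      ∑ m, Real.exp (-(2 * logConfFactor y)) * (partialDeriv 0 (ξ m) y * partialDeriv 0 (fun y ↦
        Real.exp (-(2 * logConfFactor y)) * (partialDeriv 0 (ξ m) y * partialDeriv 0 k y
          + partialDeriv 1 (ξ m) y * partialDeriv 1 k y)) y + partialDeriv 1 (ξ m) y *
        partialDeriv 1 (fun y ↦ Real.exp (-(2 * logConfFactor y)) *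
          (partialDeriv 0 (ξ m) y * partialDeriv 0 k y
          + partialDeriv 1 (ξ m) y * partialDeriv 1 k y)) y) =
      Real.exp (-(2 * logConfFactor y)) * planeLaplacian k y := by
    intro ξ k hξ hk hs
    have h0 := hξ 0
    have h1 := hξ 1
    have h2 := hξ 2
    simp only [Fin.sum_univ_three] at hs ⊢
    have s00 := funext (hs 0 0)
    have s11 := funext (hs 1 1)
    have he : Real.exp (-(2 * logConfFactor y)) * Real.exp (2 * logConfFactor y) = 1 := by
      rw [← Real.exp_add]; simp
    have d000 := congrFun (congrArg (partialDeriv 0) s00) y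
    have d001 := congrFun (congrArg (partialDeriv 1) s00) y
    have d110 := congrFun (congrArg (partialDeriv 0) s11) y
    have d111 := congrFun (congrArg (partialDeriv 1) s11) y
    have e00 := hs 0 0 y
    have e01 := hs 0 1 y
    have e11 := hs 1 1 y
    simp (disch := fun_prop) only [partialDeriv_add, partialDeriv_mul, partialDeriv_const,
      partialDeriv_exp, reduceIte, zero_ne_one, partialDeriv_comm 1 0 h0,
      partialDeriv_comm 1 0 h1, partialDeriv_comm 1 0 h2] at d000 d001 d110 d111 e00 e01 e11
    unfold planeLaplacian
    simp (disch := fun_prop) only [partialDeriv_add, partialDeriv_mul, partialDeriv_const,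
      partialDeriv_exp, partialDeriv_neg, partialDeriv_comm 1 0 h0,
      partialDeriv_comm 1 0 h1, partialDeriv_comm 1 0 h2, partialDeriv_comm 1 0 hk]
    -- The derivatives of the diagonal relations evaluate the first-order terms `∑ ∂ᵢξ ∂ᵢ∂ⱼξ` as `2
    -- e^{2l} ∂ⱼl`, which cancels the derivative of the factor `e^{-2l}`; the relations themselves
    -- leave `Δk` in second order.
    linear_combination
      Real.exp (-(2 * logConfFactor y)) ^ 2 * ((1 / 2 * d000 + 1 / 2 * d110) * partialDeriv 0 k y
        + (1 / 2 * d001 + 1 / 2 * d111) * partialDeriv 1 k y)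
      + Real.exp (-(2 * logConfFactor y)) ^ 2 *
        (-2 * partialDeriv 0 logConfFactor y * partialDeriv 0 k y
          + partialDeriv 0 (partialDeriv 0 k) y) * e00
      + Real.exp (-(2 * logConfFactor y)) ^ 2 *
        (-2 * partialDeriv 0 logConfFactor y * partialDeriv 1 k y
          - 2 * partialDeriv 1 logConfFactor y * partialDeriv 0 k y
          + 2 * partialDeriv 0 (partialDeriv 1 k) y) * e01
      + Real.exp (-(2 * logConfFactor y)) ^ 2 *
        (-2 * partialDeriv 1 logConfFactor y * partialDeriv 1 k y
          + partialDeriv 1 (partialDeriv 1 k) y) * e11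
      + Real.exp (-(2 * logConfFactor y)) * (partialDeriv 0 (partialDeriv 0 k) y
        + partialDeriv 1 (partialDeriv 1 k) y) * he
  have h1 : ∀ i, ContDiff ℝ ∞ fun z ↦ coordFun i (stereoParam p z) := fun i ↦
    contMDiff_iff_comp_stereoParam.1 (contMDiff_coordFun i) p
  refine Eq.trans ?_ (key _ _ h1 (contMDiff_iff_comp_stereoParam.1 hh p)
    fun i j y ↦ sum_partialDeriv_coordFun p i j y)
  refine Finset.sum_congr rfl fun i _ ↦ ?_
  rw [← gradInner_stereoParam (contMDiff_coordFun i) hh p]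
  exact congrFun (gradInner_stereoParam (contMDiff_coordFun i)
    (contMDiff_gradInner (contMDiff_coordFun i) hh) p) y

theorem planeLaplacian_add_logConfFactor {h : EuclideanSpace ℝ (Fin 2) → ℝ} (hh : ContDiff ℝ ∞ h)
    (y : EuclideanSpace ℝ (Fin 2)) : planeLaplacian (fun z ↦ h z + logConfFactor z) y =
      planeLaplacian h y - Real.exp (2 * logConfFactor y) := by
  have hl := contDiff_logConfFactor
  rw [sub_eq_add_neg, ← planeLaplacian_logConfFactor]
  unfold planeLaplacian
  simp (disch := fun_prop) only [partialDeriv_add]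
  ring

/-- The curvature is defined in a chart that changes with the point, which hides its smoothness.
This expresses it through globally defined smooth functions. -/
theorem gaussCurvature_eq (hf : ContMDiff (𝓡 2) 𝓘(ℝ, ℝ) ∞ f)
    (hg : ∀ (p : S2) (v w : TangentSpace (𝓡 2) p),
      g.inner p v w = Real.exp (2 * f p) * roundMetric.inner p v w) :
    gaussCurvature g = fun q ↦ Real.exp (-(2 * f q)) * (1 - sphereLaplacian f q) := by
  funext q
  have hq := stereoParam_chart (mem_chart_source (EuclideanSpace ℝ (Fin 2)) q)
  have hfq := contMDiff_iff_comp_stereoParam.1 hf q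
  have hl := contDiff_logConfFactor
  rw [gaussCurvature, metricMatrix_eq hg, coordGaussCurvature_conformal (hfq.add hl),
    planeLaplacian_add_logConfFactor hfq]
  generalize chartAt (EuclideanSpace ℝ (Fin 2)) q q = y at hq
  have h1 := sphereLaplacian_stereoParam hf q y
  rw [hq] at h1 ⊢
  have he : Real.exp (-(2 * logConfFactor y)) * Real.exp (2 * logConfFactor y) = 1 := by
    rw [← Real.exp_add]; simp
  rw [h1, mul_add, neg_add, Real.exp_add]
  linear_combination Real.exp (-(2 * f q)) * he

theorem contMDiff_gaussCurvature (hf : ContMDiff (𝓡 2) 𝓘(ℝ, ℝ) ∞ f)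
    (hg : ∀ (p : S2) (v w : TangentSpace (𝓡 2) p),
      g.inner p v w = Real.exp (2 * f p) * roundMetric.inner p v w) :
    ContMDiff (𝓡 2) 𝓘(ℝ, ℝ) ∞ (gaussCurvature g) := by
  rw [gaussCurvature_eq hf hg, contMDiff_iff_comp_stereoParam]
  intro p
  exact (contDiff_const.mul (contMDiff_iff_comp_stereoParam.1 hf p)).neg.exp.mul
    (contDiff_const.sub (contMDiff_iff_comp_stereoParam.1 (contMDiff_sphereLaplacian hf) p))

theorem gaussCurvature_stereoParam (hf : ContMDiff (𝓡 2) 𝓘(ℝ, ℝ) ∞ f)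
    (hg : ∀ (p : S2) (v w : TangentSpace (𝓡 2) p),
      g.inner p v w = Real.exp (2 * f p) * roundMetric.inner p v w) (p : S2) :
    (fun y ↦ gaussCurvature g (stereoParam p y)) = fun y ↦
      -Real.exp (-(2 * (f (stereoParam p y) + logConfFactor y))) *
        planeLaplacian (fun z ↦ f (stereoParam p z) + logConfFactor z) y := by
  funext y
  have he : Real.exp (-(2 * logConfFactor y)) * Real.exp (2 * logConfFactor y) = 1 := by
    rw [← Real.exp_add]; simp
  rw [gaussCurvature_eq hf hg]
  simp only
  rw [sphereLaplacian_stereoParam hf,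
    planeLaplacian_add_logConfFactor (contMDiff_iff_comp_stereoParam.1 hf p), mul_add, neg_add,
    Real.exp_add]
  linear_combination -Real.exp (-(2 * f (stereoParam p y))) * he

end SphereLaplacian

/-! ## Conformal Killing fields in stereographic charts -/

section ConformalKilling

variable {f : S2 → ℝ} {g : SmoothMetric 2 S2}

theorem metric_chartField (hg : ∀ (p : S2) (v w : TangentSpace (𝓡 2) p),
      g.inner p v w = Real.exp (2 * f p) * roundMetric.inner p v w)
    (p : S2) (X Y : (q : S2) → TangentSpace (𝓡 2) q) (y : EuclideanSpace ℝ (Fin 2)) :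
    g.inner (stereoParam p y) (X (stereoParam p y)) (Y (stereoParam p y)) =
      Real.exp (2 * (f (stereoParam p y) + logConfFactor y)) *
        inner ℝ (chartField p X y) (chartField p Y y) := by
  rw [← metric_mfderiv hg p, mfderiv_chartField, mfderiv_chartField]

theorem chartField_mlieBracket {X Y : (q : S2) → TangentSpace (𝓡 2) q}
    (hX : IsSmoothVectorField X) (hY : IsSmoothVectorField Y) (p : S2)
    (y : EuclideanSpace ℝ (Fin 2)) :
    chartField p (VectorField.mlieBracket (𝓡 2) X Y) y =
      fderiv ℝ (chartField p Y) y (chartField p X y) -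
        fderiv ℝ (chartField p X) y (chartField p Y y) := by
  have h := VectorField.mpullback_mlieBracket (I := 𝓡 2) (I' := 𝓡 2) (n := ∞)
    (f := stereoParam p) (x₀ := y)
    (hX.mdifferentiable (by simp) _) (hY.mdifferentiable (by simp) _)
    (contMDiff_stereoParam p y) (by simpa using WithTop.coe_le_coe.2 (le_top (a := (2 : ℕ∞))))
  rw [chartField, h]
  have h2 := congrFun (VectorField.mlieBracketWithin_eq_lieBracketWithin (𝕜 := ℝ)
    (V := chartField p X) (W := chartField p Y) (s := univ)) y
  exact h2.trans (congrFun VectorField.lieBracketWithin_univ y)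

/-- The derivatives of `Y` and `Z` from the product rule cancel those in the brackets, so only
pointwise values of `Y` and `Z` remain. -/
theorem lieDerivMetric_stereoParam (hf : ContMDiff (𝓡 2) 𝓘(ℝ, ℝ) ∞ f)
    (hg : ∀ (p : S2) (v w : TangentSpace (𝓡 2) p),
      g.inner p v w = Real.exp (2 * f p) * roundMetric.inner p v w)
    {X Y Z : (q : S2) → TangentSpace (𝓡 2) q} (hX : IsSmoothVectorField X)
    (hY : IsSmoothVectorField Y) (hZ : IsSmoothVectorField Z) (p : S2)
    (y : EuclideanSpace ℝ (Fin 2)) :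
    lieDerivMetric g X Y Z (stereoParam p y) =
      Real.exp (2 * (f (stereoParam p y) + logConfFactor y)) *
      (2 * fderiv ℝ (fun z ↦ f (stereoParam p z) + logConfFactor z) y (chartField p X y) *
          inner ℝ (chartField p Y y) (chartField p Z y)
        + inner ℝ (fderiv ℝ (chartField p X) y (chartField p Y y)) (chartField p Z y)
        + inner ℝ (chartField p Y y) (fderiv ℝ (chartField p X) y (chartField p Z y))) := by
  have hu : ∀ p, ContDiff ℝ ∞ fun z ↦ f (stereoParam p z) + logConfFactor z := fun p ↦
    (contMDiff_iff_comp_stereoParam.1 hf p).add contDiff_logConfFactor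
  have hYp := isSmoothVectorField_iff_chartField.1 hY
  have hZp := isSmoothVectorField_iff_chartField.1 hZ
  have hs : ContMDiff (𝓡 2) 𝓘(ℝ, ℝ) ∞ fun q ↦ g.inner q (Y q) (Z q) := by
    rw [contMDiff_iff_comp_stereoParam]
    intro p
    simp only [metric_chartField hg]
    exact (contDiff_const.mul (hu p)).exp.mul ((hYp p).inner ℝ (hZp p))
  rw [lieDerivMetric, mvfderiv_chartField hs, metric_chartField hg, metric_chartField hg,
    chartField_mlieBracket hX hY, chartField_mlieBracket hX hZ]
  simp only [metric_chartField hg]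
  have d1 := ((hu p).differentiable (by simp) y).hasFDerivAt
  have d2 := ((hYp p).differentiable (by simp) y).hasFDerivAt
  have d3 := ((hZp p).differentiable (by simp) y).hasFDerivAt
  have d4 := ((d1.const_mul 2).exp.mul (d2.inner ℝ d3)).fderiv
  refine (congrArg (fun t : ℝ ↦ t - _ - _)
    (congrArg (fun L ↦ L (chartField p X y)) d4)).trans ?_
  simp [inner_sub_left, inner_sub_right]
  ring

/-- The Killing condition is tested on global smooth fields, so every tangent vector must extend to
one. The gradient of the linear function dual to that vector in `ℝ³` does this, being its tangential
projection. -/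
theorem exists_chartField_eq (p : S2) (y v : EuclideanSpace ℝ (Fin 2)) :
    ∃ Y : (q : S2) → TangentSpace (𝓡 2) q, IsSmoothVectorField Y ∧ chartField p Y y = v := by
  let h : S2 → ℝ := fun q ↦ ∑ i, coordFun i q * stereoDeriv p y v i
  have hh : ContMDiff (𝓡 2) 𝓘(ℝ, ℝ) ∞ h := by
    rw [contMDiff_iff_comp_stereoParam]
    intro q
    exact ContDiff.sum fun i _ ↦
      (contMDiff_iff_comp_stereoParam.1 (contMDiff_coordFun i) q).mul contDiff_const
  refine ⟨metricGradient roundMetric h, isSmoothVectorField_metricGradient hh, ?_⟩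
  ext k
  rw [chartField_metricGradient hh]
  have hd : partialDeriv k (fun z ↦ h (stereoParam p z)) y =
      ∑ i, partialDeriv k (fun z ↦ coordFun i (stereoParam p z)) y * stereoDeriv p y v i := by
    have hc := fun i ↦ contMDiff_iff_comp_stereoParam.1 (contMDiff_coordFun i) p
    simp only [h, Fin.sum_univ_three]
    rw [partialDeriv_add _ (((hc 0).mul contDiff_const).add ((hc 1).mul contDiff_const))
      ((hc 2).mul contDiff_const), partialDeriv_add _ ((hc 0).mul contDiff_const)
      ((hc 1).mul contDiff_const), partialDeriv_mul _ (hc 0) contDiff_const,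
      partialDeriv_mul _ (hc 1) contDiff_const, partialDeriv_mul _ (hc 2) contDiff_const]
    simp [partialDeriv_const]
  have hi := inner_stereoDeriv p y v (EuclideanSpace.single k 1)
  rw [PiLp.inner_apply] at hi
  simp only [RCLike.inner_apply, conj_trivial] at hi
  simp only [hd, partialDeriv_coordFun, hi]
  rw [← mul_assoc, ← Real.exp_add]
  simp [EuclideanSpace.inner_single_right]

theorem fderiv_chartField_apply {X : (q : S2) → TangentSpace (𝓡 2) q} (hX : IsSmoothVectorField X)
    (p : S2) (y v : EuclideanSpace ℝ (Fin 2)) (i : Fin 2) :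
    fderiv ℝ (chartField p X) y v i = v 0 * partialDeriv 0 (fun z ↦ chartField p X z i) y +
      v 1 * partialDeriv 1 (fun z ↦ chartField p X z i) y := by
  have h1 := (EuclideanSpace.proj (𝕜 := ℝ) i : EuclideanSpace ℝ (Fin 2) →L[ℝ] ℝ).hasFDerivAt.comp y
    ((isSmoothVectorField_iff_chartField.1 hX p).differentiable (by simp) y).hasFDerivAt
  have h2 := congrArg (fun L ↦ L v) h1.fderiv
  have h3 := fderiv_eq_sum_partialDeriv (a := fun z ↦ chartField p X z i) y v
  rw [Fin.sum_univ_two] at h3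
  rw [← h3]
  exact h2.symm

theorem contDiff_chartField_apply {X : (q : S2) → TangentSpace (𝓡 2) q}
    (hX : IsSmoothVectorField X) (p : S2) (i : Fin 2) :
    ContDiff ℝ ∞ fun z ↦ chartField p X z i :=
  (contDiff_coord i).comp (isSmoothVectorField_iff_chartField.1 hX p)

/-- A conformal Killing field satisfies the Cauchy-Riemann equations in stereographic charts, and
its divergence is a smooth function on the sphere. -/
theorem IsConformalKilling.cauchyRiemann (hf : ContMDiff (𝓡 2) 𝓘(ℝ, ℝ) ∞ f)
    (hg : ∀ (p : S2) (v w : TangentSpace (𝓡 2) p),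
      g.inner p v w = Real.exp (2 * f p) * roundMetric.inner p v w)
    {X : (q : S2) → TangentSpace (𝓡 2) q} (hX : IsConformalKilling g X) :
    (∀ p, partialDeriv 0 (fun z ↦ chartField p X z 1) =
        fun y ↦ -partialDeriv 1 (fun z ↦ chartField p X z 0) y) ∧
    (∀ p, partialDeriv 1 (fun z ↦ chartField p X z 1) =
        partialDeriv 0 (fun z ↦ chartField p X z 0)) ∧
    ∃ D : S2 → ℝ, ContMDiff (𝓡 2) 𝓘(ℝ, ℝ) ∞ D ∧ ∀ p, (fun y ↦ D (stereoParam p y)) =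
      conformalDiv logConfFactor (fun z ↦ chartField p X z 0) (fun z ↦ chartField p X z 1) := by
  obtain ⟨hXs, Ω, hΩ⟩ := hX
  -- The Lie derivative equation tested on fields equal to `∂ᵢ`, `∂ⱼ` at `y`: the off-diagonal entry
  -- and the difference of the diagonal ones are Cauchy-Riemann.
  have key : ∀ p y (i j : Fin 2),
      2 * fderiv ℝ (fun z ↦ f (stereoParam p z) + logConfFactor z) y (chartField p X y) *
        (if i = j then 1 else 0) + partialDeriv i (fun z ↦ chartField p X z j) y +
        partialDeriv j (fun z ↦ chartField p X z i) y =
      Ω (stereoParam p y) * (if i = j then 1 else 0) := by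
    intro p y i j
    obtain ⟨Y, hY, hYy⟩ := exists_chartField_eq p y (EuclideanSpace.single i 1)
    obtain ⟨Z, hZ, hZy⟩ := exists_chartField_eq p y (EuclideanSpace.single j 1)
    have h := hΩ Y Z hY hZ (stereoParam p y)
    rw [lieDerivMetric_stereoParam hf hg hXs hY hZ, metric_chartField hg, mul_left_comm, hYy, hZy]
      at h
    have h2 := mul_left_cancel₀ (Real.exp_pos _).ne' h
    simp only [EuclideanSpace.inner_single_right, EuclideanSpace.inner_single_left,
      fderiv_chartField_apply hXs] at h2
    fin_cases i <;> fin_cases j <;> simpa using h2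
  have h0 : ∀ p, partialDeriv 0 (fun z ↦ chartField p X z 1) =
        fun y ↦ -partialDeriv 1 (fun z ↦ chartField p X z 0) y := by
    intro p
    funext y
    have := key p y 0 1
    simp at this
    linarith
  have h1 : ∀ p, partialDeriv 1 (fun z ↦ chartField p X z 1) =
        partialDeriv 0 (fun z ↦ chartField p X z 0) := by
    intro p
    funext y
    have k0 := key p y 0 0
    have k1 := key p y 1 1
    simp at k0 k1
    linarith
  -- `Ω` comes with no regularity. It is the divergence of `X` for `g`, and subtracting `2X(f)`
  -- leaves the round divergence, whose chart expression is visibly smooth.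
  have hD : ∀ p, (fun y ↦ Ω (stereoParam p y) -
      2 * mvfderiv (𝓡 2) f (stereoParam p y) (X (stereoParam p y))) =
      conformalDiv logConfFactor (fun z ↦ chartField p X z 0) (fun z ↦ chartField p X z 1) := by
    intro p
    funext y
    have k0 := key p y 0 0
    rw [fderiv_fun_add ((contMDiff_iff_comp_stereoParam.1 hf p).differentiable (by simp) y)
      (contDiff_logConfFactor.differentiable (by simp) y)] at k0
    rw [mvfderiv_chartField hf, conformalDiv, h1]
    have k1 := fderiv_eq_sum_partialDeriv (a := logConfFactor) y (chartField p X y)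
    simp only [Fin.sum_univ_two, add_apply, reduceIte] at k0 k1
    linarith
  refine ⟨h0, h1, fun q ↦ Ω q - 2 * mvfderiv (𝓡 2) f q (X q), ?_, hD⟩
  rw [contMDiff_iff_comp_stereoParam]
  intro p
  rw [hD p]
  exact contDiff_conformalDiv contDiff_logConfFactor (contDiff_chartField_apply hXs p 0)
    (contDiff_chartField_apply hXs p 1)

theorem isConformalKilling_of_cauchyRiemann (hf : ContMDiff (𝓡 2) 𝓘(ℝ, ℝ) ∞ f)
    (hg : ∀ (p : S2) (v w : TangentSpace (𝓡 2) p),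
      g.inner p v w = Real.exp (2 * f p) * roundMetric.inner p v w)
    {X : (q : S2) → TangentSpace (𝓡 2) q} (hX : IsSmoothVectorField X)
    (h0 : ∀ p y, partialDeriv 0 (fun z ↦ chartField p X z 1) y =
        -partialDeriv 1 (fun z ↦ chartField p X z 0) y)
    (h1 : ∀ p y, partialDeriv 1 (fun z ↦ chartField p X z 1) y =
        partialDeriv 0 (fun z ↦ chartField p X z 0) y) : IsConformalKilling g X := by
  -- The factor is the divergence for `g`, `2X(u) + 2∂₀a`, read at each `q` in its own chart; no
  -- smoothness is required of it.
  refine ⟨hX, fun q ↦ 2 * fderiv ℝ (fun z ↦ f (stereoParam q z) + logConfFactor z)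
      (chartAt (EuclideanSpace ℝ (Fin 2)) q q)
      (chartField q X (chartAt (EuclideanSpace ℝ (Fin 2)) q q)) +
      2 * partialDeriv 0 (fun z ↦ chartField q X z 0) (chartAt (EuclideanSpace ℝ (Fin 2)) q q), ?_⟩
  intro Y Z hY hZ q
  have key : ∀ p y, lieDerivMetric g X Y Z (stereoParam p y) =
      (2 * fderiv ℝ (fun z ↦ f (stereoParam p z) + logConfFactor z) y (chartField p X y) +
        2 * partialDeriv 0 (fun z ↦ chartField p X z 0) y) *
        g.inner (stereoParam p y) (Y (stereoParam p y)) (Z (stereoParam p y)) := by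
    intro p y
    rw [lieDerivMetric_stereoParam hf hg hX hY hZ, metric_chartField hg]
    simp only [PiLp.inner_apply, Fin.sum_univ_two, RCLike.inner_apply, conj_trivial,
      fderiv_chartField_apply hX, h0, h1]
    ring
  have h := key q (chartAt (EuclideanSpace ℝ (Fin 2)) q q)
  rwa [stereoParam_chart (mem_chart_source _ q)] at h

theorem chartField_gradient_coordFun (p : S2) (i : Fin 3) (j : Fin 2) :
    (fun y ↦ chartField p (metricGradient roundMetric (coordFun i)) y j) = fun y ↦
      stereoFrame p (EuclideanSpace.single j 1) i * (1 / 4) * (y 0 * y 0 + y 1 * y 1 + 4)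
      - (p : EuclideanSpace ℝ (Fin 3)) i * y j - 1 / 2 * y j *
      (stereoFrame p (EuclideanSpace.single 0 1) i * y 0 +
        stereoFrame p (EuclideanSpace.single 1 1) i * y 1) := by
  funext y
  have hy : y = y 0 • EuclideanSpace.single 0 (1 : ℝ) + y 1 • EuclideanSpace.single 1 (1 : ℝ) := by
    ext k; fin_cases k <;> simp
  have hF : stereoFrame p y i = stereoFrame p (EuclideanSpace.single 0 1) i * y 0 +
        stereoFrame p (EuclideanSpace.single 1 1) i * y 1 := by
    conv_lhs => rw [hy]
    simp [mul_comm]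
  rw [chartField_metricGradient (contMDiff_coordFun i), partialDeriv_coordFun, stereoDeriv_eq,
    Real.exp_neg, exp_two_mul_logConfFactor, ← norm_sq_eq, ← hF]
  simp [EuclideanSpace.inner_single_right]
  field_simp
  ring

theorem isConformalKilling_gradient_coordFun (hf : ContMDiff (𝓡 2) 𝓘(ℝ, ℝ) ∞ f)
    (hg : ∀ (p : S2) (v w : TangentSpace (𝓡 2) p),
      g.inner p v w = Real.exp (2 * f p) * roundMetric.inner p v w) (i : Fin 3) :
    IsConformalKilling g (metricGradient roundMetric (coordFun i)) := by
  apply isConformalKilling_of_cauchyRiemann hf hg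
    (isSmoothVectorField_metricGradient (contMDiff_coordFun i))
  all_goals
    intro p y
    simp (disch := fun_prop) only [chartField_gradient_coordFun, partialDeriv_add, partialDeriv_sub,
      partialDeriv_mul, partialDeriv_const, partialDeriv_coord]
    simp
    ring

end ConformalKilling

/-! ## The Riemannian volume in a stereographic chart -/

section Volume

variable {f : S2 → ℝ} {g : SmoothMetric 2 S2}

/-- In dimension two the Gram determinant is both `(det L)²` and `c²`. -/
theorem abs_det_of_inner_eq {L : EuclideanSpace ℝ (Fin 2) →L[ℝ] EuclideanSpace ℝ (Fin 2)} {c : ℝ}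
    (hc : 0 ≤ c) (h : ∀ v w, inner ℝ (L v) (L w) = c * inner ℝ v w) : |L.det| = c := by
  let b := (EuclideanSpace.basisFun (Fin 2) ℝ).toBasis
  have hd : L.det = (LinearMap.toMatrix b b (L : EuclideanSpace ℝ (Fin 2) →ₗ[ℝ] _)).det :=
    (LinearMap.det_toMatrix b _).symm
  rw [← abs_of_nonneg hc, ← sq_eq_sq_iff_abs_eq_abs, hd, Matrix.det_fin_two]
  simp only [LinearMap.toMatrix_apply]
  have h00 := h (b 0) (b 0)
  have h01 := h (b 0) (b 1)
  have h11 := h (b 1) (b 1)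
  simp only [PiLp.inner_apply, Fin.sum_univ_two, RCLike.inner_apply, conj_trivial] at h00 h01 h11
  simp [b] at h00 h01 h11 ⊢
  set x := L (EuclideanSpace.single 0 1)
  set z := L (EuclideanSpace.single 1 1)
  linear_combination (z 0 * z 0 + z 1 * z 1) * h00 + c * h11 - (z 0 * x 0 + z 1 * x 1) * h01

theorem chartVolume_apply (hg : ∀ (p : S2) (v w : TangentSpace (𝓡 2) p),
      g.inner p v w = Real.exp (2 * f p) * roundMetric.inner p v w) (p : S2) {s : Set S2}
    (hs : MeasurableSet s) : chartVolume g p s = ∫⁻ y in stereoParam p ⁻¹' s,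
      ENNReal.ofReal (Real.exp (2 * (f (stereoParam p y) + logConfFactor y))) := by
  have hψ := (continuous_stereoParam p).measurable
  rw [chartVolume, chart_target, Measure.restrict_univ, metricMatrix_eq hg]
  refine (Measure.map_apply hψ hs).trans ?_
  rw [withDensity_apply _ (hψ hs)]
  refine lintegral_congr fun y ↦ ?_
  congr 1
  rw [Matrix.det_smul, Matrix.det_one, mul_one, Fintype.card_fin, Real.sqrt_sq (Real.exp_pos _).le]

/-- Both parametrizations are conformal into the same `ℝ³`, so the transition map scales lengths by
the quotient of the two factors and areas by its square. -/
theorem hasFDerivAt_transition {p q : S2} {y : EuclideanSpace ℝ (Fin 2)}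
    (hy : stereoParam q y ∈ (chartAt (EuclideanSpace ℝ (Fin 2)) p).source) :
    ∃ L : EuclideanSpace ℝ (Fin 2) →L[ℝ] EuclideanSpace ℝ (Fin 2),
      HasFDerivAt (fun z ↦ chartAt (EuclideanSpace ℝ (Fin 2)) p (stereoParam q z)) L y ∧
      |L.det| * Real.exp (2 * logConfFactor (chartAt (EuclideanSpace ℝ (Fin 2)) p (stereoParam q y)))
        = Real.exp (2 * logConfFactor y) := by
  have h1 : MDifferentiableAt (𝓡 2) (𝓡 2)
      (fun z ↦ chartAt (EuclideanSpace ℝ (Fin 2)) p (stereoParam q z)) y :=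
    ((mdifferentiable_chart (I := 𝓡 2) p).mdifferentiableAt hy).comp y
      (mdifferentiable_stereoParam q y)
  have h2 := (mdifferentiableAt_iff_differentiableAt.1 h1).hasFDerivAt
  refine ⟨_, h2, ?_⟩
  set T := fun z ↦ chartAt (EuclideanSpace ℝ (Fin 2)) p (stereoParam q z) with hT
  have h3 : ∀ v, stereoDeriv p (T y) (fderiv ℝ T y v) = stereoDeriv q y v := by
    intro v
    have h4 := ((contDiff_coe_stereoParam p).differentiable (by simp) (T y)).hasFDerivAt.comp y h2
    have h5 : (fun z ↦ (stereoParam q z : EuclideanSpace ℝ (Fin 3))) =ᶠ[nhds y]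
        ((fun z ↦ (stereoParam p z : EuclideanSpace ℝ (Fin 3))) ∘ T) := by
      filter_upwards [((chartAt (EuclideanSpace ℝ (Fin 2)) p).open_source.preimage
        (continuous_stereoParam q)).mem_nhds hy] with z hz
      simp [hT, stereoParam_chart hz]
    exact (congrArg (fun L ↦ L v) (h4.congr_of_eventuallyEq h5).fderiv).symm
  have h6 : |(fderiv ℝ T y).det| =
      Real.exp (-(2 * logConfFactor (T y))) * Real.exp (2 * logConfFactor y) := by
    refine abs_det_of_inner_eq (by positivity) fun v w ↦ ?_
    have h7 := inner_stereoDeriv p (T y) (fderiv ℝ T y v) (fderiv ℝ T y w)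
    rw [h3, h3, inner_stereoDeriv] at h7
    rw [mul_assoc, h7, ← mul_assoc, ← Real.exp_add]
    simp
  change |(fderiv ℝ T y).det| * Real.exp (2 * logConfFactor (T y)) = _
  rw [h6, mul_right_comm, ← Real.exp_add]
  simp

/-- Change of variables along the transition map; the one point missed by the chart at `p` is null.
By symmetry all chart volumes agree, so their supremum can be computed in any single chart. -/
theorem chartVolume_le (hg : ∀ (p : S2) (v w : TangentSpace (𝓡 2) p),
      g.inner p v w = Real.exp (2 * f p) * roundMetric.inner p v w) (p q : S2) :
    chartVolume g q ≤ chartVolume g p := by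
  refine Measure.le_iff.2 fun s hs ↦ ?_
  rw [chartVolume_apply hg q hs, chartVolume_apply hg p hs]
  set T := fun z ↦ chartAt (EuclideanSpace ℝ (Fin 2)) p (stereoParam q z) with hT
  set A := stereoParam q ⁻¹' (s ∩ (chartAt (EuclideanSpace ℝ (Fin 2)) p).source) with hA
  have hAm : MeasurableSet A := (continuous_stereoParam q).measurable
    (hs.inter (chartAt (EuclideanSpace ℝ (Fin 2)) p).open_source.measurableSet)
  have hTψ : ∀ y ∈ A, stereoParam p (T y) = stereoParam q y := fun y hy ↦ stereoParam_chart hy.2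
  have hinj : InjOn T A := by
    intro y hy z hz h
    apply stereoParam_injective q
    rw [← hTψ y hy, ← hTψ z hz, h]
  choose! L hL hdet using fun y (hy : y ∈ A) ↦ hasFDerivAt_transition (p := p) (q := q) hy.2
  have hsub : stereoParam q ⁻¹' s ⊆ A ∪ stereoParam q ⁻¹' {-p} := by
    intro y hy
    by_cases h : stereoParam q y = -p
    · exact Or.inr h
    · exact Or.inl ⟨hy, by rw [chart_source]; exact h⟩
  have hnull : volume (stereoParam q ⁻¹' {-p}) = 0 :=
    ((subsingleton_singleton).preimage (stereoParam_injective q)).measure_zero _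
  calc _ ≤ ∫⁻ y in A ∪ stereoParam q ⁻¹' {-p},
        ENNReal.ofReal (Real.exp (2 * (f (stereoParam q y) + logConfFactor y))) :=
        lintegral_mono_set hsub
    _ = ∫⁻ y in A, ENNReal.ofReal (Real.exp (2 * (f (stereoParam q y) + logConfFactor y))) :=
        setLIntegral_congr (union_ae_eq_left_of_ae_eq_empty (ae_eq_empty.2 hnull))
    _ = ∫⁻ y in A, ENNReal.ofReal |(L y).det| *
          ENNReal.ofReal (Real.exp (2 * (f (stereoParam p (T y)) + logConfFactor (T y)))) := by
        refine setLIntegral_congr_fun hAm fun y hy ↦ ?_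
        beta_reduce
        rw [← ENNReal.ofReal_mul (abs_nonneg _), hTψ y hy, mul_add, mul_add, Real.exp_add,
          Real.exp_add, mul_left_comm, hdet y hy]
    _ = ∫⁻ y in T '' A, ENNReal.ofReal (Real.exp (2 * (f (stereoParam p y) + logConfFactor y))) :=
        (lintegral_image_eq_lintegral_abs_det_fderiv_mul volume hAm
          (fun y hy ↦ (hL y hy).hasFDerivWithinAt) hinj fun y ↦
          ENNReal.ofReal (Real.exp (2 * (f (stereoParam p y) + logConfFactor y)))).symm
    _ ≤ _ := by
        refine lintegral_mono_set ?_
        rintro _ ⟨y, hy, rfl⟩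
        rw [mem_preimage, hTψ y hy]
        exact hy.1

theorem riemannianVolume_eq_chartVolume (hg : ∀ (p : S2) (v w : TangentSpace (𝓡 2) p),
      g.inner p v w = Real.exp (2 * f p) * roundMetric.inner p v w) (p : S2) :
    riemannianVolume g = chartVolume g p :=
  le_antisymm (iSup_le fun q ↦ chartVolume_le hg p q) (le_iSup (chartVolume g) p)

theorem riemannianVolume_eq_map (hg : ∀ (p : S2) (v w : TangentSpace (𝓡 2) p),
      g.inner p v w = Real.exp (2 * f p) * roundMetric.inner p v w) (p : S2) :
    riemannianVolume g = Measure.map (stereoParam p) (volume.withDensity fun y ↦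
      ENNReal.ofReal (Real.exp (2 * (f (stereoParam p y) + logConfFactor y)))) := by
  rw [riemannianVolume_eq_chartVolume hg p]
  ext s hs
  have hψ := (continuous_stereoParam p).measurable
  rw [chartVolume_apply hg p hs, Measure.map_apply hψ hs, withDensity_apply _ (hψ hs)]

theorem measurableEmbedding_stereoParam (p : S2) : MeasurableEmbedding (stereoParam p) :=
  ((chartAt (EuclideanSpace ℝ (Fin 2)) p).symm.isOpenEmbedding
    (by rw [OpenPartialHomeomorph.symm_source, chart_target])).measurableEmbedding

theorem measurable_conformalDensity (hf : ContMDiff (𝓡 2) 𝓘(ℝ, ℝ) ∞ f) (p : S2) :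
    Measurable fun y ↦
      ENNReal.ofReal (Real.exp (2 * (f (stereoParam p y) + logConfFactor y))) :=
  (contDiff_const.mul ((contMDiff_iff_comp_stereoParam.1 hf p).add
    contDiff_logConfFactor)).exp.continuous.measurable.ennreal_ofReal

theorem integrable_riemannianVolume_iff (hf : ContMDiff (𝓡 2) 𝓘(ℝ, ℝ) ∞ f)
    (hg : ∀ (p : S2) (v w : TangentSpace (𝓡 2) p),
      g.inner p v w = Real.exp (2 * f p) * roundMetric.inner p v w) (p : S2) (F : S2 → ℝ) :
    Integrable F (riemannianVolume g) ↔ Integrable fun y ↦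
      Real.exp (2 * (f (stereoParam p y) + logConfFactor y)) * F (stereoParam p y) := by
  rw [riemannianVolume_eq_map hg p, (measurableEmbedding_stereoParam p).integrable_map_iff,
    integrable_withDensity_iff_integrable_smul' (measurable_conformalDensity hf p) (by simp)]
  simp only [ENNReal.toReal_ofReal (Real.exp_pos _).le, smul_eq_mul, Function.comp_apply]

theorem integral_riemannianVolume (hf : ContMDiff (𝓡 2) 𝓘(ℝ, ℝ) ∞ f)
    (hg : ∀ (p : S2) (v w : TangentSpace (𝓡 2) p),
      g.inner p v w = Real.exp (2 * f p) * roundMetric.inner p v w) (p : S2) (F : S2 → ℝ) :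
    ∫ q, F q ∂(riemannianVolume g) =
      ∫ y, Real.exp (2 * (f (stereoParam p y) + logConfFactor y)) * F (stereoParam p y) := by
  rw [riemannianVolume_eq_map hg p, (measurableEmbedding_stereoParam p).integral_map,
    integral_withDensity_eq_integral_toReal_smul (measurable_conformalDensity hf p) (by simp)]
  simp only [ENNReal.toReal_ofReal (Real.exp_pos _).le, smul_eq_mul]

end Volume

/-! ## The Kazdan-Warner identities -/

section KazdanWarner

open Asymptotics

variable {f : S2 → ℝ} {g : SmoothMetric 2 S2}

/-- Compactness of the sphere. The filter `⊤` makes this and the later estimates hold at every `y`,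
not only near infinity. -/
theorem isBigO_comp_stereoParam {h : S2 → ℝ} (hh : Continuous h) (p : S2) :
    (fun y ↦ h (stereoParam p y)) =O[⊤] fun _ ↦ (1 : ℝ) := by
  obtain ⟨C, hC⟩ := isCompact_univ.exists_bound_of_continuousOn hh.continuousOn
  refine IsBigO.of_bound C ?_
  simpa using fun y ↦ hC (stereoParam p y) (mem_univ _)

/-- The round gradient norm squared, `e^{-2l}|∂h|²`, is bounded on the sphere. -/
theorem isBigO_partialDeriv_comp_stereoParam {h : S2 → ℝ} (hh : ContMDiff (𝓡 2) 𝓘(ℝ, ℝ) ∞ h)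
    (p : S2) (i : Fin 2) :
    partialDeriv i (fun y ↦ h (stereoParam p y)) =O[⊤] fun y ↦ Real.exp (logConfFactor y) := by
  have h1 := isBigO_comp_stereoParam (contMDiff_gradInner hh hh).continuous p
  rw [gradInner_stereoParam hh hh] at h1
  apply IsBigO.of_pow two_ne_zero
  simp only [Pi.pow_def]
  have h2 := h1.mul (isBigO_refl (fun y ↦ Real.exp (2 * logConfFactor y)) ⊤)
  refine (IsBigO.of_bound 1 ?_).trans (h2.congr_right fun y ↦ ?_)
  · refine Filter.Eventually.of_forall fun y ↦ ?_
    have he : Real.exp (-(2 * logConfFactor y)) * Real.exp (2 * logConfFactor y) = 1 := by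
      rw [← Real.exp_add]; simp
    rw [mul_right_comm, he, one_mul, one_mul, Real.norm_of_nonneg (sq_nonneg _), Real.norm_of_nonneg
      (add_nonneg (mul_self_nonneg _) (mul_self_nonneg _))]
    fin_cases i <;> simp <;> nlinarith [mul_self_nonneg (partialDeriv 0 (fun y ↦ h (stereoParam p y)) y),
      mul_self_nonneg (partialDeriv 1 (fun y ↦ h (stereoParam p y)) y)]
  · rw [one_mul, pow_two, ← Real.exp_add, two_mul]

/-- The round length squared, `e^{2l}|X|²`, is bounded on the sphere; the components may grow
quadratically in the chart. -/
theorem isBigO_chartField {X : (q : S2) → TangentSpace (𝓡 2) q} (hX : IsSmoothVectorField X)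
    (p : S2) (i : Fin 2) :
    (fun y ↦ chartField p X y i) =O[⊤] fun y ↦ Real.exp (-logConfFactor y) := by
  have hs : ContMDiff (𝓡 2) 𝓘(ℝ, ℝ) ∞ fun q ↦ roundInner q (X q) (X q) := by
    rw [contMDiff_iff_comp_stereoParam]
    intro p
    simp only [roundInner_chartField]
    have hXp := isSmoothVectorField_iff_chartField.1 hX p
    exact (contDiff_const.mul contDiff_logConfFactor).exp.mul (hXp.inner ℝ hXp)
  have h1 := isBigO_comp_stereoParam hs.continuous p
  simp only [roundInner_chartField] at h1
  apply IsBigO.of_pow two_ne_zero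
  simp only [Pi.pow_def]
  have h2 := h1.mul (isBigO_refl (fun y ↦ Real.exp (-(2 * logConfFactor y))) ⊤)
  refine (IsBigO.of_bound 1 ?_).trans (h2.congr_right fun y ↦ ?_)
  · refine Filter.Eventually.of_forall fun y ↦ ?_
    have he : Real.exp (2 * logConfFactor y) * Real.exp (-(2 * logConfFactor y)) = 1 := by
      rw [← Real.exp_add]; simp
    rw [mul_right_comm, he, one_mul, one_mul, Real.norm_of_nonneg (sq_nonneg _),
      Real.norm_of_nonneg real_inner_self_nonneg, real_inner_self_eq_norm_sq, norm_sq_eq]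
    fin_cases i <;> simp <;> nlinarith [mul_self_nonneg (chartField p X y 0),
      mul_self_nonneg (chartField p X y 1)]
  · rw [one_mul, pow_two, ← Real.exp_add]
    congr 1
    ring

theorem exp_logConfFactor_le (y : EuclideanSpace ℝ (Fin 2)) :
    Real.exp (logConfFactor y) ≤ 5 / (1 + ‖y‖) ^ 2 := by
  rw [exp_logConfFactor, div_le_div_iff₀ (by positivity) (by positivity)]
  -- The constant 5 is sharp: `5(t² + 4) - 4(1 + t)² = (t - 4)²`.
  nlinarith [sq_nonneg (‖y‖ - 4)]

theorem integrable_of_isBigO_exp {F : EuclideanSpace ℝ (Fin 2) → ℝ} (hF : Continuous F)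
    (h : F =O[⊤] fun y ↦ Real.exp (2 * logConfFactor y)) : Integrable F := by
  obtain ⟨C, hC0, hC⟩ := h.exists_nonneg
  rw [IsBigOWith, Filter.eventually_top] at hC
  refine (integrable_inv_one_add_norm_pow_three.const_mul (C * 25)).mono' hF.aestronglyMeasurable
    (Filter.Eventually.of_forall fun y ↦ (hC y).trans ?_)
  rw [Real.norm_of_nonneg (Real.exp_pos _).le, mul_assoc]
  gcongr
  rw [two_mul, Real.exp_add]
  have h1 : 1 ≤ 1 + ‖y‖ := by linarith [norm_nonneg y]
  calc _ ≤ (5 / (1 + ‖y‖) ^ 2) * (5 / (1 + ‖y‖) ^ 2) := by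
        gcongr <;> exact exp_logConfFactor_le y
    _ = 25 * ((1 + ‖y‖) ^ 4)⁻¹ := by field_simp; norm_num
    _ ≤ _ := by
        gcongr
        · norm_num

/-- Weights are counted: functions have weight `1`, gradients `e^l`, field components `e^{-l}`, and
`e^{2l} - ΔF` has `e^{2l}`. Each of the six terms then has weight `e^l`. -/
theorem isBigO_kazdanWarnerFlux {F D a b c : EuclideanSpace ℝ (Fin 2) → ℝ} {i : Fin 2}
    (hF : F =O[⊤] fun _ ↦ (1 : ℝ))
    (hdF : ∀ j, partialDeriv j F =O[⊤] fun y ↦ Real.exp (logConfFactor y))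
    (hlap : (fun y ↦ Real.exp (2 * logConfFactor y) - planeLaplacian F y) =O[⊤]
      fun y ↦ Real.exp (2 * logConfFactor y))
    (hD : D =O[⊤] fun _ ↦ (1 : ℝ))
    (hdD : partialDeriv i D =O[⊤] fun y ↦ Real.exp (logConfFactor y))
    (hDe : D = conformalDiv logConfFactor a b)
    (ha : a =O[⊤] fun y ↦ Real.exp (-logConfFactor y))
    (hb : b =O[⊤] fun y ↦ Real.exp (-logConfFactor y))
    (hc : c =O[⊤] fun y ↦ Real.exp (-logConfFactor y)) :
    kazdanWarnerFlux F logConfFactor a b c i =O[⊤] fun y ↦ Real.exp (logConfFactor y) := by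
  have hr := isBigO_refl (fun y ↦ Real.exp (2 * logConfFactor y)) ⊤
  have h1 := (isBigO_refl (fun _ : EuclideanSpace ℝ (Fin 2) ↦ (1 : ℝ)) ⊤).add
    (hF.const_mul_left 2)
  have t1 := hlap.mul hc
  have t2 := (h1.mul hr).mul hc
  have t3 := hD.mul (hdF i)
  have t4 := hF.mul hdD
  have t5 := ((((ha.mul (hdF 0)).add (hb.mul (hdF 1))).const_mul_left 2)).mul (hdF i)
  have t6 := (((hdF 0).pow 2).add ((hdF 1).pow 2)).mul hc
  have e1 : ∀ t : ℝ, Real.exp (2 * t) * Real.exp (-t) = Real.exp t := fun t ↦ by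
    rw [← Real.exp_add]; ring_nf
  have e2 : ∀ t : ℝ, Real.exp (-t) * Real.exp t = 1 := fun t ↦ by
    rw [← Real.exp_add]; simp
  have e3 : ∀ t : ℝ, Real.exp t ^ 2 = Real.exp (2 * t) := fun t ↦ by
    rw [pow_two, ← Real.exp_add, two_mul]
  simp only [e1, e2, e3, one_mul] at t1 t2 t3 t4 t5 t6
  unfold kazdanWarnerFlux
  rw [← hDe]
  exact ((((t1.sub t2).add t3).sub t4).add t5).sub t6

/-- Stated for all larger constants so that both flux components can share one. -/
theorem isBigO_top_bound {V : EuclideanSpace ℝ (Fin 2) → ℝ}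
    (hV : V =O[⊤] fun y ↦ Real.exp (logConfFactor y)) :
    ∃ C, ∀ C' ≥ C, ∀ y, |V y| ≤ C' / (1 + ‖y‖) ^ 2 := by
  obtain ⟨C, hC0, hC⟩ := hV.exists_nonneg
  rw [IsBigOWith, Filter.eventually_top] at hC
  refine ⟨C * 5, fun C' hC' y ↦ (hC y).trans ?_⟩
  rw [Real.norm_of_nonneg (Real.exp_pos _).le]
  calc _ ≤ C * (5 / (1 + ‖y‖) ^ 2) := by gcongr; exact exp_logConfFactor_le y
    _ = (C * 5) / (1 + ‖y‖) ^ 2 := by ring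
    _ ≤ _ := by gcongr

/-- The generalized Kazdan-Warner identity, for the derivative of the curvature along a conformal
Killing field. -/
theorem integral_mvfderiv_gaussCurvature (hf : ContMDiff (𝓡 2) 𝓘(ℝ, ℝ) ∞ f)
    (hg : ∀ (p : S2) (v w : TangentSpace (𝓡 2) p),
      g.inner p v w = Real.exp (2 * f p) * roundMetric.inner p v w)
    {X : (q : S2) → TangentSpace (𝓡 2) q} (hX : IsConformalKilling g X) :
    Integrable (fun q ↦ mvfderiv (𝓡 2) (gaussCurvature g) q (X q)) (riemannianVolume g) ∧
    ∫ q, mvfderiv (𝓡 2) (gaussCurvature g) q (X q) ∂(riemannianVolume g) = 0 := by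
  have hK := contMDiff_gaussCurvature hf hg
  obtain ⟨h0, h1, D, hD, hDe⟩ := hX.cauchyRiemann hf hg
  have hXs := hX.1
  -- Any point serves as the centre of the chart.
  let p : S2 := ⟨EuclideanSpace.single 0 1, by simp⟩
  have hfp := contMDiff_iff_comp_stereoParam.1 hf p
  have hl := contDiff_logConfFactor
  have ha := contDiff_chartField_apply hXs p 0
  have hb := contDiff_chartField_apply hXs p 1
  rw [integrable_riemannianVolume_iff hf hg p, integral_riemannianVolume hf hg p]
  have hdiv : (fun y ↦ Real.exp (2 * (f (stereoParam p y) + logConfFactor y)) *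
      mvfderiv (𝓡 2) (gaussCurvature g) (stereoParam p y) (X (stereoParam p y))) = fun y ↦
      partialDeriv 0 (kazdanWarnerFlux (fun z ↦ f (stereoParam p z)) logConfFactor
        (fun z ↦ chartField p X z 0) (fun z ↦ chartField p X z 1)
        (fun z ↦ chartField p X z 0) 0) y +
      partialDeriv 1 (kazdanWarnerFlux (fun z ↦ f (stereoParam p z)) logConfFactor
        (fun z ↦ chartField p X z 0) (fun z ↦ chartField p X z 1)
        (fun z ↦ chartField p X z 1) 1) y := by
    funext y
    rw [div_kazdanWarnerFlux hfp hl ha hb (h0 p) (h1 p) planeLaplacian_logConfFactor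
      (gaussCurvature_stereoParam hf hg p), mvfderiv_chartField hK, fderiv_eq_sum_partialDeriv,
      Fin.sum_univ_two]
  have hs : ContMDiff (𝓡 2) 𝓘(ℝ, ℝ) ∞ fun q ↦ mvfderiv (𝓡 2) (gaussCurvature g) q (X q) := by
    rw [contMDiff_iff_comp_stereoParam]
    intro q
    simp only [mvfderiv_chartField hK, fderiv_eq_sum_partialDeriv, Fin.sum_univ_two]
    have hKq := contMDiff_iff_comp_stereoParam.1 hK q
    exact ((contDiff_chartField_apply hXs q 0).mul (contDiff_partialDeriv hKq 0)).add
      ((contDiff_chartField_apply hXs q 1).mul (contDiff_partialDeriv hKq 1))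
  have hint : Integrable fun y ↦ Real.exp (2 * (f (stereoParam p y) + logConfFactor y)) *
      mvfderiv (𝓡 2) (gaussCurvature g) (stereoParam p y) (X (stereoParam p y)) := by
    apply integrable_of_isBigO_exp
    · exact ((contDiff_const.mul (hfp.add hl)).exp.mul
        (contMDiff_iff_comp_stereoParam.1 hs p)).continuous
    · have hexp := isBigO_comp_stereoParam
        (h := fun q ↦ Real.exp (2 * f q))
        (Real.continuous_exp.comp (continuous_const.mul hf.continuous)) p
      have := (hexp.mul (isBigO_refl (fun y ↦ Real.exp (2 * logConfFactor y)) ⊤)).mul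
        (isBigO_comp_stereoParam hs.continuous p)
      simpa only [← Real.exp_add, ← mul_add, one_mul, mul_one] using this
  refine ⟨hint, ?_⟩
  rw [hdiv] at hint ⊢
  have hlap : (fun y ↦ Real.exp (2 * logConfFactor y) -
      planeLaplacian (fun z ↦ f (stereoParam p z)) y) =O[⊤]
      fun y ↦ Real.exp (2 * logConfFactor y) := by
    have hb1 := isBigO_comp_stereoParam (h := fun q ↦ 1 - sphereLaplacian f q)
      (continuous_const.sub (contMDiff_sphereLaplacian hf).continuous) p
    refine ((isBigO_refl (fun y ↦ Real.exp (2 * logConfFactor y)) ⊤).mul hb1).congr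
      (fun y ↦ ?_) fun y ↦ mul_one _
    have he : Real.exp (2 * logConfFactor y) * Real.exp (-(2 * logConfFactor y)) = 1 := by
      rw [← Real.exp_add]; simp
    rw [sphereLaplacian_stereoParam hf]
    linear_combination -planeLaplacian (fun z ↦ f (stereoParam p z)) y * he
  have hflux : ∀ i, kazdanWarnerFlux (fun z ↦ f (stereoParam p z)) logConfFactor
      (fun z ↦ chartField p X z 0) (fun z ↦ chartField p X z 1) (fun z ↦ chartField p X z i) i
      =O[⊤] fun y ↦ Real.exp (logConfFactor y) := fun i ↦
    isBigO_kazdanWarnerFlux (isBigO_comp_stereoParam hf.continuous p)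
      (isBigO_partialDeriv_comp_stereoParam hf p) hlap (isBigO_comp_stereoParam hD.continuous p)
      (isBigO_partialDeriv_comp_stereoParam hD p i) (hDe p) (isBigO_chartField hXs p 0)
      (isBigO_chartField hXs p 1) (isBigO_chartField hXs p i)
  obtain ⟨C0, hC0⟩ := isBigO_top_bound (hflux 0)
  obtain ⟨C1, hC1⟩ := isBigO_top_bound (hflux 1)
  exact integral_div_eq_zero (contDiff_kazdanWarnerFlux hfp hl ha hb ha 0)
    (contDiff_kazdanWarnerFlux hfp hl ha hb hb 1) (hC0 (max C0 C1) (le_max_left _ _))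
    (hC1 (max C0 C1) (le_max_right _ _)) hint

end KazdanWarner

end

theorem mainTheorem1 (f : S2 → ℝ) (hf : ContMDiff (𝓡 2) 𝓘(ℝ, ℝ) ∞ f) (g : SmoothMetric 2 S2)
    (hg : ∀ (p : S2) (v w : TangentSpace (𝓡 2) p),
      g.inner p v w = Real.exp (2 * f p) * roundMetric.inner p v w) :
    ContMDiff (𝓡 2) 𝓘(ℝ, ℝ) ∞ (gaussCurvature g) ∧
    (∀ X : (p : S2) → TangentSpace (𝓡 2) p, IsConformalKilling g X →
      Integrable (fun p ↦ g.inner p (metricGradient g (gaussCurvature g) p) (X p))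
        (riemannianVolume g) ∧
      ∫ p, g.inner p (metricGradient g (gaussCurvature g) p) (X p) ∂(riemannianVolume g) = 0) ∧
    (∀ i : Fin 3,
      IsConformalKilling g (metricGradient roundMetric (coordFun i)) ∧
      Integrable (fun p ↦ roundMetric.inner p (metricGradient roundMetric (gaussCurvature g) p)
        (metricGradient roundMetric (coordFun i) p)) (riemannianVolume g) ∧
      ∫ p, roundMetric.inner p (metricGradient roundMetric (gaussCurvature g) p)
        (metricGradient roundMetric (coordFun i) p) ∂(riemannianVolume g) = 0) := by
  refine ⟨contMDiff_gaussCurvature hf hg, fun X hX ↦ ?_, fun i ↦ ?_⟩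
  -- Each metric pairs its own gradient with `X` to `dK(X)`, so the metric disappears from the
  -- integrand.
  · simp only [inner_metricGradient]
    exact integral_mvfderiv_gaussCurvature hf hg hX
  · have hX := isConformalKilling_gradient_coordFun hf hg i
    simp only [inner_metricGradient]
    exact ⟨hX, integral_mvfderiv_gaussCurvature hf hg hX⟩
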